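/- Let $0\le k<n$ be integers with $n\ge 2$, and let $\lambda=(n-k,1,\dots,1)\vdash n$ (with $k$ ones). Let $X=X^\lambda$ be the set of tabloids of shape $\lambda$ with entries $1,\dots,n$, i.e. of fillings of the diagram of $\lambda$ by $1,\dots,n$ without repetition, up to reordering entries within rows. Let $S_n$ act on $X$ by permuting entries and on the space $\mathbb{C}X$ of functions $f:X\to\mathbb{C}$ by $(g\cdot f)(x)=f(g^{-1}x)$, and for $1\le j\le n$ let $S_j\le S_n$ be the subgroup fixing $j+1,\dots,n$. For each $1\le j\le n$ let $\mathcal{R}(S_j)$ be a maximal set of pairwise inequivalent irreducible complex matrix representations of $S_j$. A basis $\mathcal{B}$ of $\mathbb{C}X$ is *symmetry adapted* with respect to $\mathcal{R}(S_j)$ if, after a suitable ordering of $\mathcal B$, the matrices $[g]_{\mathcal{B}}$ of all $g\in S_j$ are simultaneously block diagonal, each block being $g\mapsto\rho(g)$ for some $\rho\in\mathcal{R}(S_j)$. Assume that $\mathcal{R}(S_1),\dots,\mathcal{R}(S_n)$ are *compatible* with respect to $\mathbb{C}X$, i.e. some basis of $\mathbb{C}X$ is symmetry adapted with respect to all of them.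 Let $\mathcal{B}_1,\dots,\mathcal{B}_n$ be bases of $\mathbb{C}X$ such that $\mathcal{B}_1$ is the standard basis (the indicator functions of the points of $X$) and, for $1\le j\le n$, $\mathcal{B}_j$ is symmetry adapted with respect to each of $\mathcal{R}(S_1),\dots,\mathcal{R}(S_j)$ and is orbital for $S_j$, i.e. each vector of $\mathcal{B}_j$ is supported on a single $S_j$-orbit of $X$. Let $C(\mathcal{B}_n,\mathcal{B}_1)$ be the change of basis matrix, so that $C(\mathcal{B}_n,\mathcal{B}_1)[f]_{\mathcal{B}_1}=[f]_{\mathcal{B}_n}$ for all $f\in\mathbb{C}X$. For a complex $m\times m$ matrix $A$ let $\omega(A)$ be the least number of arithmetic operations (additions, subtractions, and multiplications by complex constants) in a straight-line computation of $Av$ from the entries of an arbitrary vector $v\in\mathbb{C}^m$ (the constant $0$ being free). For partitions $\mu,\nu$ let $d_{\mu/\nu}$ be the number of standard skew tableaux of shape $\mu/\nu$, with $d_{\mu/\nu}=0$ if $\mu$ does not contain $\nu$. For $\ell\ge r\ge0$ let $D(\ell,r)=\{\mu\vdash\ell:\mu_1\ge r\}$; for integers $n'>k$ put $$M(n',k)=\max_{\mu\in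 D(n'-1,\,n'-k-1)}\bigl\{d_{\mu/(n'-k-1)}+k\,d_{\mu/(n'-k)}\bigr\},\qquad N(k)=\max_{n'>k}M(n',k),$$ where $(r)$ denotes the one-row partition of $r$ (empty for $r=0$). Write $(n)_k=n(n-1)\cdots(n-k+1)$. Then $$\omega\bigl(C(\mathcal{B}_n,\mathcal{B}_1)\bigr)<2N(k)(n-1)(n)_k ,$$ and also the naive bound $\omega\bigl(C(\mathcal{B}_n,\mathcal{B}_1)\bigr)<2\bigl((n)_k\bigr)^2$ holds. -/

import Mathlib

namespace TabloidFFT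

/-! ### Arithmetic cost of a matrix-vector product -/

/-- `Computes t S`: some straight-line computation on an input vector `x` with entries `x i`,
using exactly `t` arithmetic operations (additions, subtractions, multiplications by a complex
constant), makes all quantities in `S` available. A quantity is a function of the input `x`.
The input entries and the constant `0` are available at no cost. -/
inductive Computes {ι : Type} : ℕ → Set ((ι → ℂ) → ℂ) → Prop
  | init : Computes 0 (insert (fun _ => 0) (Set.range fun (i : ι) (x : ι → ℂ) => x i))
  | add {t : ℕ} {S : Set ((ι → ℂ) → ℂ)} {u v : (ι → ℂ) → ℂ} :
      Computes t S → u ∈ S → v ∈ S → Computes (t + 1) (insert (fun x => u x + v x) S)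
  | sub {t : ℕ} {S : Set ((ι → ℂ) → ℂ)} {u v : (ι → ℂ) → ℂ} :
      Computes t S → u ∈ S → v ∈ S → Computes (t + 1) (insert (fun x => u x - v x) S)
  | smul {t : ℕ} {S : Set ((ι → ℂ) → ℂ)} {u : (ι → ℂ) → ℂ} (c : ℂ) :
      Computes t S → u ∈ S → Computes (t + 1) (insert (fun x => c * u x) S)

/-- The least number of arithmetic operations with which all entries of `A x` can be computed
from an arbitrary vector `x`. -/
noncomputable def omega {ι : Type} [Fintype ι] (A : Matrix ι ι ℂ) : ℕ :=
  sInf {t | ∃ S, Computes t S ∧ ∀ i, (fun x : ι → ℂ => A.mulVec x i) ∈ S}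

/-- Every matrix-vector product can be computed, so the infimum defining `omega` is a minimum. -/
theorem omega_spec {ι : Type} [Fintype ι] (A : Matrix ι ι ℂ) :
    ∃ S, Computes (omega A) S ∧ ∀ i, (fun x : ι → ℂ => A.mulVec x i) ∈ S := by
  classical
  have base : ∀ {t : ℕ} {S : Set ((ι → ℂ) → ℂ)}, Computes t S →
      (fun _ => 0) ∈ S ∧ ∀ i, (fun x : ι → ℂ => x i) ∈ S := by
    intro t S h
    induction h with
    | init => exact ⟨Or.inl rfl, fun i => Or.inr ⟨i, rfl⟩⟩
    | add _ _ _ ih => exact ⟨Or.inr ih.1, fun i => Or.inr (ih.2 i)⟩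
    | sub _ _ _ ih => exact ⟨Or.inr ih.1, fun i => Or.inr (ih.2 i)⟩
    | smul _ _ _ ih => exact ⟨Or.inr ih.1, fun i => Or.inr (ih.2 i)⟩
  have form : ∀ (a : ι → ℂ) (s : Finset ι) {t : ℕ} {S : Set ((ι → ℂ) → ℂ)}, Computes t S →
      ∃ t' S', Computes t' S' ∧ S ⊆ S' ∧ (fun x : ι → ℂ => ∑ i ∈ s, a i * x i) ∈ S' := by
    intro a s t S h
    induction s using Finset.induction_on with
    | empty => exact ⟨t, S, h, subset_rfl, by simpa using (base h).1⟩
    | insert i s hi ih =>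
      obtain ⟨t', S', h', hS, hm⟩ := ih
      refine ⟨_, _, ((h'.smul (a i) ((base h').2 i)).add (Or.inl rfl) (Or.inr hm)),
        fun u hu => Or.inr (Or.inr (hS hu)), Or.inl ?_⟩
      funext x
      rw [Finset.sum_insert hi]
  have all : ∀ s : Finset ι, ∃ t S, Computes t S ∧
      ∀ i ∈ s, (fun x : ι → ℂ => A.mulVec x i) ∈ S := by
    intro s
    induction s using Finset.induction_on with
    | empty => exact ⟨0, _, Computes.init, by simp⟩
    | insert i s hi ih =>
      obtain ⟨t, S, h, hm⟩ := ih
      obtain ⟨t', S', h', hS, hf⟩ := form (A i) Finset.univ h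
      refine ⟨t', S', h', fun j hj => ?_⟩
      rcases Finset.mem_insert.1 hj with rfl | hj
      · exact hf
      · exact hS (hm j hj)
  obtain ⟨t, S, h, hm⟩ := all Finset.univ
  have hne : {t | ∃ S, Computes t S ∧ ∀ i, (fun x : ι → ℂ => A.mulVec x i) ∈ S}.Nonempty :=
    ⟨t, S, h, fun i => hm i (Finset.mem_univ i)⟩
  exact Nat.sInf_mem hne

/-! ### Matrix representations and symmetry adapted bases -/

/-- A complex matrix representation of the group `G`. -/
structure MatRep (G : Type) [Group G] where
  dim : ℕ
  hom : G →* Matrix (Fin dim) (Fin dim) ℂ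

/-- The action of `G` on column vectors given by a matrix representation. -/
noncomputable def MatRep.toRep {G : Type} [Group G] (ρ : MatRep G) :
    Representation ℂ G (Fin ρ.dim → ℂ) :=
  (Matrix.toLinAlgEquiv' : Matrix (Fin ρ.dim) (Fin ρ.dim) ℂ ≃ₐ[ℂ] _).toMonoidHom.comp ρ.hom

/-- `R` is a maximal set of pairwise inequivalent irreducible matrix representations of `G`. -/
structure IsIrredSystem {G : Type} [Group G] (R : Set (MatRep G)) : Prop where
  irreducible : ∀ ρ ∈ R, ρ.toRep.IsIrreducible
  inequivalent : ∀ ρ ∈ R, ∀ ρ' ∈ R, Nonempty (ρ.toRep.Equiv ρ'.toRep) → ρ = ρ'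
  maximal : ∀ ρ : MatRep G, ρ.toRep.IsIrreducible → ∃ ρ' ∈ R, Nonempty (ρ.toRep.Equiv ρ'.toRep)

/-- The permutation module `ℂX`: the functions on `X` with `(g · f) x = f (g⁻¹ x)`. -/
def permRep (G X : Type) [Group G] [MulAction G X] : Representation ℂ G (X → ℂ) where
  toFun g := LinearMap.funLeft ℂ ℂ fun x => g⁻¹ • x
  map_one' := by
    ext f x
    simp [LinearMap.funLeft_apply]
  map_mul' g h := by
    ext f x
    simp [LinearMap.funLeft_apply, mul_smul]

/-- `b` is a symmetry adapted basis with respect to `R`: the basis vectors can be arranged so that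
the matrices of all `g` are block diagonal with the same blocks, where the block number `s` is
`ρ s (g)` for some `ρ s ∈ R`. -/
def IsSymmetryAdapted {G V ι : Type} [Group G] [AddCommGroup V] [Module ℂ V] [Fintype ι]
    [DecidableEq ι] (τ : Representation ℂ G V) (R : Set (MatRep G)) (b : Module.Basis ι ℂ V) :
    Prop :=
  ∃ (r : ℕ) (ρ : Fin r → MatRep G) (e : ι ≃ (s : Fin r) × Fin (ρ s).dim),
    (∀ s, ρ s ∈ R) ∧
    ∀ g, (LinearMap.toMatrix b b (τ g)).reindex e e =
      Matrix.blockDiagonal' fun s => (ρ s).hom g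

/-- Every basis vector is supported on a single `G`-orbit, that is, lies in one of the
summands `ℂX₁, …, ℂXₜ` belonging to the orbits `X₁, …, Xₜ`; the basis is then a
disjoint union of bases of these summands. -/
def IsOrbital (G : Type) {X ι : Type} [Group G] [MulAction G X]
    (b : Module.Basis ι ℂ (X → ℂ)) : Prop :=
  ∀ i, ∃ x, ∀ y, b i y ≠ 0 → y ∈ MulAction.orbit G x

/-- `b` is the standard basis of `ℂX` (for some enumeration of `X`). -/
def IsStandard {X ι : Type} [DecidableEq X] (b : Module.Basis ι ℂ (X → ℂ)) : Prop :=
  ∃ e : ι ≃ X, ∀ i, b i = Pi.single (e i) 1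

/-! ### The chain of symmetric groups -/

/-- `S_j` inside the symmetric group of `Fin n`: the permutations that move only the first
`j` points. -/
abbrev symSub (n j : ℕ) : Subgroup (Equiv.Perm (Fin n)) :=
  fixingSubgroup (Equiv.Perm (Fin n)) {i : Fin n | j ≤ (i : ℕ)}

/-- `b` is symmetry adapted with respect to the list `R 1, …, R j`. -/
def IsAdaptedUpTo {n : ℕ} {X ι : Type} [MulAction (Equiv.Perm (Fin n)) X] [Fintype ι]
    [DecidableEq ι] (R : (j : ℕ) → Set (MatRep (symSub n j))) (j : ℕ)
    (b : Module.Basis ι ℂ (X → ℂ)) : Prop :=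
  ∀ i, 1 ≤ i → i ≤ j → IsSymmetryAdapted (permRep (symSub n i) X) (R i) b

/-- The systems `R 1, …, R n` are compatible with respect to `ℂX`: some basis is symmetry adapted
with respect to all of them. -/
def AreCompatible {n : ℕ} (X : Type) [MulAction (Equiv.Perm (Fin n)) X]
    (R : (j : ℕ) → Set (MatRep (symSub n j))) : Prop :=
  ∃ (m : ℕ) (b : Module.Basis (Fin m) ℂ (X → ℂ)), IsAdaptedUpTo R n b

/-! ### Tabloids -/

/-- A tabloid of shape `α` with entries in `Fin n`. A row-equivalence class of tableaux is given
by the row in which each entry stands, row `i` having `α i` entries. -/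
def Tabloid {r : ℕ} (n : ℕ) (α : Fin r → ℕ) : Type :=
  {T : Fin n → Fin r // ∀ i, (Finset.univ.filter fun a => T a = i).card = α i}

instance {r n : ℕ} (α : Fin r → ℕ) : DecidableEq (Tabloid n α) :=
  inferInstanceAs (DecidableEq {_T : Fin n → Fin r // _})

/-- `σ · T` is obtained by applying `σ` to every entry: the entry `σ a` of `σ · T` stands in
the row of the entry `a` of `T`. -/
instance {r n : ℕ} (α : Fin r → ℕ) : MulAction (Equiv.Perm (Fin n)) (Tabloid n α) where
  smul σ T := ⟨fun a => T.1 (σ⁻¹ a), fun i => by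
    rw [← T.2 i]
    exact Finset.card_equiv σ⁻¹ (by simp)⟩
  one_smul _ := rfl
  mul_smul _ _ _ := rfl

/-- The shape `(n - k, 1, …, 1)` with `k` ones. -/
def hook (n k : ℕ) : Fin (k + 1) → ℕ := Fin.cons (n - k) fun _ => 1

/-! ### Standard skew tableaux and the constants `M(n,k)`, `N(k)` -/

/-- The standard skew tableaux of shape `μ / ν`. -/
def StdSkewTableau (μ ν : YoungDiagram) : Type :=
  {T : {c // c ∈ μ.cells \ ν.cells} ≃ Fin (μ.cells \ ν.cells).card //
    (∀ c c', c.1.1 = c'.1.1 → c.1.2 < c'.1.2 → T c < T c') ∧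
    (∀ c c', c.1.2 = c'.1.2 → c.1.1 < c'.1.1 → T c < T c')}

open Classical in
/-- `d_{μ/ν}`, which is `0` if `μ` does not contain `ν`. -/
noncomputable def numSkew (μ ν : YoungDiagram) : ℕ :=
  if ν ≤ μ then Nat.card (StdSkewTableau μ ν) else 0

/-- The partition `(r)` with a single part (the empty partition if `r = 0`). -/
def oneRow (r : ℕ) : YoungDiagram := YoungDiagram.ofRowLens [r] (List.pairwise_singleton _ r).sortedGE

/-- The partitions of `l` with first part at least `r`. -/
def D (l r : ℕ) : Set YoungDiagram := {μ | μ.card = l ∧ r ≤ μ.rowLen 0}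

/-- `M(n,k)`, for `k < n`. -/
noncomputable def M (n k : ℕ) : ℕ :=
  sSup ((fun μ => numSkew μ (oneRow (n - k - 1)) + k * numSkew μ (oneRow (n - k))) ''
    D (n - 1) (n - k - 1))

/-- `N(k)`. -/
noncomputable def N (k : ℕ) : ℕ := sSup ((fun n => M n k) '' {n | k < n})

/-! The suprema that define `M(n,k)` and `N(k)` are maxima. -/

theorem card_oneRow (r : ℕ) : (oneRow r).card = r := by
  have : (oneRow r).cells = ({0} : Finset ℕ) ×ˢ Finset.range r := by
    ext ⟨i, j⟩
    rw [YoungDiagram.mem_cells, oneRow, YoungDiagram.mem_ofRowLens]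
    simp only [Finset.mem_product, Finset.mem_singleton, Finset.mem_range, List.length_singleton,
      List.getElem_singleton, exists_prop]
    omega
  rw [YoungDiagram.card, this]
  simp

theorem numSkew_le (μ : YoungDiagram) (r : ℕ) :
    numSkew μ (oneRow r) ≤ (μ.card - r).factorial := by
  classical
  unfold numSkew
  split_ifs with h
  · have hc : (μ.cells \ (oneRow r).cells).card = μ.card - r := by
      rw [Finset.card_sdiff_of_subset (YoungDiagram.cells_subset_iff.2 h)]
      have := card_oneRow r
      rw [YoungDiagram.card] at this
      rw [this]
    calc Nat.card (StdSkewTableau μ (oneRow r))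
        ≤ Nat.card ({c // c ∈ μ.cells \ (oneRow r).cells} ≃
            Fin (μ.cells \ (oneRow r).cells).card) :=
          Nat.card_le_card_of_injective _ Subtype.val_injective
      _ = (μ.card - r).factorial := by
          rw [Nat.card_eq_fintype_card, Fintype.card_equiv (Finset.equivFin _)]
          simp only [Fintype.card_coe]
          rw [hc]
  · exact Nat.zero_le _

theorem isGreatest_M {n k : ℕ} (h : k < n) :
    IsGreatest ((fun μ => numSkew μ (oneRow (n - k - 1)) + k * numSkew μ (oneRow (n - k))) ''
      D (n - 1) (n - k - 1)) (M n k) ∧ M n k ≤ k.factorial + k * k.factorial := by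
  have hb : ∀ v ∈ ((fun μ => numSkew μ (oneRow (n - k - 1)) + k * numSkew μ (oneRow (n - k))) ''
      D (n - 1) (n - k - 1)), v ≤ k.factorial + k * k.factorial := by
    rintro _ ⟨μ, ⟨hμ, -⟩, rfl⟩
    have h1 := numSkew_le μ (n - k - 1)
    have h2 := numSkew_le μ (n - k)
    have e1 : (μ.card - (n - k - 1)).factorial ≤ k.factorial := Nat.factorial_le (by omega)
    have e2 : (μ.card - (n - k)).factorial ≤ k.factorial := Nat.factorial_le (by omega)
    exact Nat.add_le_add (h1.trans e1) (Nat.mul_le_mul_left _ (h2.trans e2))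
  have hne : (D (n - 1) (n - k - 1)).Nonempty := by
    refine ⟨oneRow (n - 1), card_oneRow _, ?_⟩
    by_contra hlt
    have hmem : (0, (oneRow (n - 1)).rowLen 0) ∈ oneRow (n - 1) := by
      rw [oneRow, YoungDiagram.mem_ofRowLens]
      refine ⟨by simp, ?_⟩
      simp only [List.getElem_cons_zero]
      rw [← oneRow]
      omega
    exact lt_irrefl _ (YoungDiagram.mem_iff_lt_rowLen.1 hmem)
  have hmem := Nat.sSup_mem (hne.image _) ⟨_, hb⟩
  exact ⟨⟨hmem, fun v hv => le_csSup ⟨_, hb⟩ hv⟩, hb _ hmem⟩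

theorem isGreatest_N (k : ℕ) : IsGreatest ((fun n => M n k) '' {n | k < n}) (N k) := by
  have hb : BddAbove ((fun n => M n k) '' {n | k < n}) := by
    refine ⟨k.factorial + k * k.factorial, ?_⟩
    rintro _ ⟨n, hn, rfl⟩
    exact (isGreatest_M hn).2
  exact ⟨Nat.sSup_mem ⟨_, ⟨k + 1, Nat.lt_succ_self k, rfl⟩⟩ hb, fun v hv => le_csSup hb hv⟩

end TabloidFFT

namespace TabloidFFT

/-! The change of basis from `B 1` to `B n` is the product of the changes from `B l` to `B (l + 1)`,
so it suffices that each factor has at most `N k` nonzero entries in each row. A row with `e ≥ 1`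
nonzero entries costs `e` multiplications and `e - 1` additions; the saved addition makes both
inequalities strict.

For the sparsity (`card_nonzero_le_N`), fix a row `i`. Both bases are adapted to the same
representations of `S_l`, so by Schur's lemma (`IsIrredSystem.schur`) the entry at `i, i'` can be
nonzero only if `i` and `i'` have the same position in blocks with the same representation σ.
Orbitality confines the vectors `i'` to one `S_{l+1}`-orbit `O`. The projections onto their blocks
are linearly independent `S_l`-maps from `ℂO` to σ, so their number is at most the dimension of the
space of such maps (`card_intertwiners_le_N`).

Let `z` be the number of first-row entries among the first `l + 1` points; it is constant on `O`.
The `S_l`-orbits in `O` are distinguished by the row of the point `l` (counted from 0). If that is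
the first row, the stabilizer is conjugate to `S_{z-1}`; for each of the `l + 1 - z ≤ k` possible
single-cell rows it is conjugate to `S_z`. An equivariant map is determined by an invariant vector
for each orbit, which gives the bound `dim σ^{S_{z-1}} + k dim σ^{S_z}`.

These dimensions are bounded in the manner of Okounkov and Vershik
(`IsCoxeter.finrank_fixedVectors_le`). The Jucys–Murphy operators, `jm s i` being the sum of the
transpositions of `i` with smaller points, commute and have a joint eigenvector; its eigenvalues are
the contents of a standard tableau (`IsWeight.exists_isPath`). The operators `step` exchange
consecutive eigenvalues. Normal-form words in them span σ by irreducibility, their nonzero values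
are determined by their weights, and these weights are tableaux of one shape μ. A vector fixed by
`S_r` is orthogonal to all of them except those whose weight starts with `0, 1, …, r - 1`, and such
tableaux are standard skew tableaux of shape μ/(r). For `z ≥ 1`, appending cells until μ has `z - 1
+ k` cells turns the bound into a term of `M (z + k) k`. -/

/-! ### Standard tableaux as content sequences -/

/-- `μ` arises from `κ` by adding the cell `b`. -/
def AddCell (κ : YoungDiagram) (b : ℕ × ℕ) (μ : YoungDiagram) : Prop :=
  b ∉ κ ∧ ∀ c, c ∈ μ ↔ c = b ∨ c ∈ κ

/-- The content of a cell. -/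
def content (b : ℕ × ℕ) : ℝ := (b.2 : ℝ) - b.1

/-- The first `q` terms of `a` are the contents of the entries of a standard tableau of
shape `μ`. -/
inductive IsPath : YoungDiagram → ℕ → (ℕ → ℝ) → Prop
  | nil (a : ℕ → ℝ) : IsPath ⊥ 0 a
  | snoc {κ μ : YoungDiagram} {q : ℕ} {a : ℕ → ℝ} {b : ℕ × ℕ} :
      IsPath κ q a → AddCell κ b μ → a q = content b → IsPath μ (q + 1) a

theorem AddCell.mem_of_le {κ μ : YoungDiagram} {b c : ℕ × ℕ} (h : AddCell κ b μ) (hc : c ≤ b)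
    (hne : c ≠ b) : c ∈ κ :=
  ((h.2 c).1 (μ.isLowerSet hc ((h.2 b).2 (Or.inl rfl)))).resolve_left hne

theorem AddCell.not_le {κ μ μ' : YoungDiagram} {b b' : ℕ × ℕ} (h : AddCell κ b μ)
    (h' : AddCell κ b' μ') (hne : b ≠ b') : ¬ b ≤ b' :=
  fun hle => h.1 (h'.mem_of_le hle hne)

/-- Two cells that can be added to the same diagram have contents that differ by at least two. -/
theorem AddCell.content_sub {κ μ μ' : YoungDiagram} {b b' : ℕ × ℕ} (h : AddCell κ b μ)
    (h' : AddCell κ b' μ') (hne : b ≠ b') :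
    content b + 2 ≤ content b' ∨ content b' + 2 ≤ content b := by
  have h1 := h.not_le h' hne
  have h2 := h'.not_le h hne.symm
  obtain ⟨i, j⟩ := b
  obtain ⟨i', j'⟩ := b'
  simp only [Prod.mk_le_mk, not_and] at h1 h2
  simp only [content]
  -- Neither cell dominates the other, so one lies strictly lower and strictly further left; each
  -- coordinate contributes at least one to the difference.
  rcases le_total i i' with hi | hi
  · right
    have := h1 hi
    have h3 : i < i' := by
      by_contra hcon
      have := h2 (by omega)
      omega
    have e1 : (j' : ℝ) + 1 ≤ j := by exact_mod_cast (_root_.not_le.1 this)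
    have e2 : (i : ℝ) + 1 ≤ i' := by exact_mod_cast h3
    linarith
  · left
    have := h2 hi
    have h3 : i' < i := by
      by_contra hcon
      have := h1 (by omega)
      omega
    have e1 : (j : ℝ) + 1 ≤ j' := by exact_mod_cast (_root_.not_le.1 this)
    have e2 : (i' : ℝ) + 1 ≤ i := by exact_mod_cast h3
    linarith

theorem AddCell.eq_of_content_eq {κ μ μ' : YoungDiagram} {b b' : ℕ × ℕ} (h : AddCell κ b μ)
    (h' : AddCell κ b' μ') (hc : content b = content b') : b = b' := by
  by_contra hne
  rcases h.content_sub h' hne with h1 | h1 <;> linarith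

theorem AddCell.unique {κ μ μ' : YoungDiagram} {b : ℕ × ℕ} (h : AddCell κ b μ)
    (h' : AddCell κ b μ') : μ = μ' :=
  SetLike.ext fun c => (h.2 c).trans (h'.2 c).symm

theorem AddCell.card {κ μ : YoungDiagram} {b : ℕ × ℕ} (h : AddCell κ b μ) :
    μ.card = κ.card + 1 := by
  have : μ.cells = insert b κ.cells := by
    ext c
    rw [Finset.mem_insert, YoungDiagram.mem_cells, YoungDiagram.mem_cells, h.2]
  rw [YoungDiagram.card, this, Finset.card_insert_of_notMem h.1]

/-- A cell can be added as soon as its upper and left neighbours are present. -/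
theorem exists_addCell {κ : YoungDiagram} {b : ℕ × ℕ} (hb : b ∉ κ)
    (hlow : ∀ c, c ≤ b → c ≠ b → c ∈ κ) : ∃ μ, AddCell κ b μ := by
  have hl : IsLowerSet ((insert b κ.cells : Finset (ℕ × ℕ)) : Set (ℕ × ℕ)) := by
    intro c d hdc hc
    rw [Finset.mem_coe, Finset.mem_insert, YoungDiagram.mem_cells] at hc ⊢
    rcases hc with rfl | hc
    · by_cases h : d = c
      · exact Or.inl h
      · exact Or.inr (hlow d hdc h)
    · exact Or.inr (κ.isLowerSet hdc hc)
  exact ⟨⟨_, hl⟩, hb, fun c => by rw [YoungDiagram.mem_mk, Finset.mem_insert,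
    YoungDiagram.mem_cells]⟩

/-- A cell without a right and a lower neighbour can be removed. -/
theorem exists_removeCell {μ : YoungDiagram} {i j : ℕ} (hb : (i, j) ∈ μ)
    (h1 : (i + 1, j) ∉ μ) (h2 : (i, j + 1) ∉ μ) : ∃ κ, AddCell κ (i, j) μ := by
  have hl : IsLowerSet ((μ.cells.erase (i, j) : Finset (ℕ × ℕ)) : Set (ℕ × ℕ)) := by
    rintro ⟨c1, c2⟩ ⟨d1, d2⟩ hdc hc
    rw [Finset.mem_coe, Finset.mem_erase, YoungDiagram.mem_cells] at hc ⊢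
    refine ⟨?_, μ.isLowerSet hdc hc.2⟩
    rintro h
    obtain ⟨rfl, rfl⟩ := Prod.mk.inj h
    have hle : d1 ≤ c1 ∧ d2 ≤ c2 := hdc
    rcases Nat.lt_or_ge d1 c1 with h3 | h3
    · exact h1 (μ.up_left_mem h3 hle.2 hc.2)
    · rcases Nat.lt_or_ge d2 c2 with h4 | h4
      · exact h2 (μ.up_left_mem hle.1 h4 hc.2)
      · exact hc.1 (Prod.ext (le_antisymm h3 hle.1) (le_antisymm h4 hle.2))
  refine ⟨⟨_, hl⟩, ?_, fun c => ?_⟩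
  · rw [YoungDiagram.mem_mk, Finset.mem_erase]
    exact fun h => h.1 rfl
  · rw [YoungDiagram.mem_mk c (μ.cells.erase (i, j)), Finset.mem_erase, YoungDiagram.mem_cells]
    by_cases h : c = (i, j)
    · simp [h, hb]
    · simp [h]

/-- Two cells that can be added separately can be added one after the other. -/
theorem AddCell.exists_both {κ lam lam' : YoungDiagram} {b b' : ℕ × ℕ} (h : AddCell κ b lam)
    (h' : AddCell κ b' lam') (hne : b ≠ b') : ∃ μ, AddCell lam b' μ ∧ AddCell lam' b μ := by
  refine ⟨lam ⊔ lam', ⟨?_, fun c => ?_⟩, ⟨?_, fun c => ?_⟩⟩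
  · rw [h.2]; exact fun hc => hc.elim (fun e => hne e.symm) h'.1
  · rw [YoungDiagram.mem_sup, h.2, h'.2]; tauto
  · rw [h'.2]; exact fun hc => hc.elim hne h.1
  · rw [YoungDiagram.mem_sup, h.2, h'.2]; tauto

/-- Two cells that can be removed separately can be removed one after the other. -/
theorem AddCell.exists_neither {μ lam lam' : YoungDiagram} {b b' : ℕ × ℕ} (h : AddCell lam b μ)
    (h' : AddCell lam' b' μ) (hne : b ≠ b') : ∃ κ, AddCell κ b' lam ∧ AddCell κ b lam' := by
  have hb' : b' ∈ lam := ((h.2 b').1 ((h'.2 b').2 (Or.inl rfl))).resolve_left hne.symm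
  have hb : b ∈ lam' := ((h'.2 b).1 ((h.2 b).2 (Or.inl rfl))).resolve_left hne
  refine ⟨lam ⊓ lam', ⟨?_, fun c => ?_⟩, ⟨?_, fun c => ?_⟩⟩
  · rw [YoungDiagram.mem_inf]; exact fun hc => h'.1 hc.2
  · rw [YoungDiagram.mem_inf]
    by_cases hc : c = b'
    · subst hc; simp [hb']
    · have : c ∈ lam → c ∈ lam' := fun hm => ((h'.2 c).1 ((h.2 c).2 (Or.inr hm))).resolve_left hc
      tauto
  · rw [YoungDiagram.mem_inf]; exact fun hc => h.1 hc.1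
  · rw [YoungDiagram.mem_inf]
    by_cases hc : c = b
    · subst hc; simp [hb]
    · have : c ∈ lam' → c ∈ lam := fun hm => ((h.2 c).1 ((h'.2 c).2 (Or.inr hm))).resolve_left hc
      tauto

/-- Two consecutively added cells that are not neighbours can be added in the other order. -/
theorem AddCell.exists_swap {κ lam μ : YoungDiagram} {b b' : ℕ × ℕ} (h : AddCell κ b lam)
    (h' : AddCell lam b' μ) (h1 : content b' ≠ content b + 1) (h2 : content b' ≠ content b - 1) :
    ∃ lam', AddCell κ b' lam' ∧ AddCell lam' b μ := by
  have hne : b ≠ b' := fun e => h'.1 ((h.2 b').2 (Or.inl e.symm))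
  have hb' : b' ∉ κ := fun hm => h'.1 ((h.2 b').2 (Or.inr hm))
  -- A further cell between `b` and `b'` would lie in `κ` and force `b` into `κ`. So `b ≤ b'` would
  -- make the two cells neighbours, with contents differing by one.
  have hbet : ∀ c, b ≤ c → c ≤ b' → c = b ∨ c = b' := by
    intro c hbc hcb
    by_contra hcon
    push Not at hcon
    exact h.1 (κ.isLowerSet hbc (((h.2 c).1 (h'.mem_of_le hcb hcon.2)).resolve_left hcon.1))
  have hnle : ¬ b ≤ b' := by
    obtain ⟨i, j⟩ := b
    obtain ⟨i', j'⟩ := b'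
    rintro ⟨hi, hj⟩
    simp only at hi hj
    have k1 := hbet (i + 1, j)
    have k2 := hbet (i, j + 1)
    simp only [Prod.mk_le_mk, Prod.mk.injEq] at k1 k2
    simp only [content] at h1 h2
    simp only [ne_eq, Prod.mk.injEq] at hne
    rcases Nat.lt_or_ge i i' with h3 | h3
    · have : i + 1 = i' ∧ j = j' := by omega
      apply h2
      rw [← this.1, ← this.2]
      push_cast
      ring
    · have : i = i' ∧ j + 1 = j' := by omega
      apply h1
      rw [← this.1, ← this.2]
      push_cast
      ring
  obtain ⟨lam', hlam'⟩ := exists_addCell hb' fun c hc hcb =>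
    ((h.2 c).1 (h'.mem_of_le hc hcb)).resolve_left fun e => hnle (e ▸ hc)
  obtain ⟨μ', hμ, hμ'⟩ := h.exists_both hlam' hne
  exact ⟨lam', hlam', hμ.unique h' ▸ hμ'⟩

theorem IsPath.congr {μ : YoungDiagram} {q : ℕ} {a a' : ℕ → ℝ} (h : IsPath μ q a)
    (haa : ∀ t < q, a t = a' t) : IsPath μ q a' := by
  induction h with
  | nil => exact .nil _
  | @snoc κ μ q a b h hc hb ih =>
    exact .snoc (ih fun t ht => haa t (by omega)) hc (by rw [← haa q (by omega), hb])

theorem IsPath.card {μ : YoungDiagram} {q : ℕ} {a : ℕ → ℝ} (h : IsPath μ q a) : μ.card = q := by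
  induction h with
  | nil => rfl
  | snoc h hc hb ih => rw [hc.card, ih]

theorem IsPath.exists_snoc {μ : YoungDiagram} {q : ℕ} {a : ℕ → ℝ} (h : IsPath μ (q + 1) a) :
    ∃ κ b, IsPath κ q a ∧ AddCell κ b μ ∧ a q = content b := by
  cases h with
  | snoc h hc hb => exact ⟨_, _, h, hc, hb⟩

/-- Distinct addable cells have distinct contents, so each content determines the next cell and the
sequence determines the whole chain of diagrams. -/
theorem IsPath.unique {μ μ' : YoungDiagram} {q : ℕ} {a : ℕ → ℝ} (h : IsPath μ q a)
    (h' : IsPath μ' q a) : μ = μ' := by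
  induction h generalizing μ' with
  | nil => cases h'; rfl
  | snoc h hc hb ih =>
    obtain ⟨κ', b', h'', hc', hb'⟩ := h'.exists_snoc
    obtain rfl := ih h''
    obtain rfl := hc.eq_of_content_eq hc' (hb.symm.trans hb')
    exact hc.unique hc'

/-- Consecutive entries of a standard tableau that are not neighbours can be exchanged. -/
theorem IsPath.swap {μ : YoungDiagram} {q : ℕ} {a : ℕ → ℝ} (h : IsPath μ q a) {i : ℕ}
    (hi : i + 1 < q) (h1 : a (i + 1) ≠ a i + 1) (h2 : a (i + 1) ≠ a i - 1) :
    IsPath μ q (a ∘ Equiv.swap i (i + 1)) := by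
  induction h with
  | nil => omega
  | @snoc lam μ q a b' h hc hb ih =>
    rcases Nat.lt_or_ge (i + 1) q with h3 | h3
    · refine .snoc (ih h3 h1 h2) hc ?_
      rw [Function.comp_apply, Equiv.swap_apply_of_ne_of_ne (by omega) (by omega), hb]
    · obtain rfl : q = i + 1 := by omega
      obtain ⟨κ, b, hκ, hbc, hbb⟩ := h.exists_snoc
      rw [hb, hbb] at h1 h2
      obtain ⟨lam', e1, e2⟩ := hbc.exists_swap hc h1 h2
      refine .snoc (.snoc (hκ.congr fun t ht => ?_) e1 ?_) e2 ?_
      · rw [Function.comp_apply, Equiv.swap_apply_of_ne_of_ne (by omega) (by omega)]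
      · rw [Function.comp_apply, Equiv.swap_apply_left, hb]
      · rw [Function.comp_apply, Equiv.swap_apply_right, hbb]

/-- Every content sequence can be continued. -/
theorem IsPath.exists_extend {μ : YoungDiagram} {q : ℕ} {a : ℕ → ℝ} (h : IsPath μ q a) (t : ℕ) :
    ∃ μ' a', IsPath μ' (q + t) a' ∧ ∀ i < q, a' i = a i := by
  induction t with
  | zero => exact ⟨μ, a, h, fun _ _ => rfl⟩
  | succ t ih =>
    obtain ⟨μ', a', h', haa⟩ := ih
    -- The foot of the first column always admits a new cell.
    have hb : (μ'.colLen 0, 0) ∉ μ' := by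
      rw [YoungDiagram.mem_iff_lt_colLen]
      exact lt_irrefl _
    obtain ⟨μ'', hμ''⟩ := exists_addCell hb (by
      rintro ⟨c1, c2⟩ ⟨hc1, hc2⟩ hne
      simp only [nonpos_iff_eq_zero] at hc1 hc2
      subst hc2
      rw [YoungDiagram.mem_iff_lt_colLen]
      exact lt_of_le_of_ne hc1 fun e => hne (by rw [e]))
    refine ⟨μ'', Function.update a' (q + t) (content (μ'.colLen 0, 0)),
      .snoc (h'.congr fun i hi => ?_) hμ'' (Function.update_self _ _ _), fun i hi => ?_⟩
    · rw [Function.update_of_ne (by omega)]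
    · rw [Function.update_of_ne (by omega), haa i hi]

theorem mem_oneRow {r : ℕ} {c : ℕ × ℕ} : c ∈ oneRow r ↔ c.1 = 0 ∧ c.2 < r := by
  obtain ⟨i, j⟩ := c
  rw [oneRow, YoungDiagram.mem_ofRowLens]
  simp only [List.length_singleton, Nat.lt_one_iff, List.getElem_singleton, exists_prop]

theorem isPath_oneRow (r : ℕ) : IsPath (oneRow r) r fun t => (t : ℝ) := by
  induction r with
  | zero =>
    have : oneRow 0 = ⊥ := SetLike.ext fun c => by
      rw [mem_oneRow]
      exact ⟨fun h => absurd h.2 (Nat.not_lt_zero _), fun h => absurd h (YoungDiagram.notMem_bot c)⟩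
    rw [this]
    exact .nil _
  | succ r ih =>
    refine .snoc (b := (0, r)) ih ⟨fun h => lt_irrefl _ (mem_oneRow.1 h).2, fun c => ?_⟩
      (by simp [content])
    rw [mem_oneRow, mem_oneRow, Prod.ext_iff]
    simp only
    omega

/-- The standard tableau that belongs to a content sequence. -/
theorem IsPath.exists_tableau {μ : YoungDiagram} {q : ℕ} {a : ℕ → ℝ} (h : IsPath μ q a) :
    ∃ T : ℕ × ℕ → ℕ, (∀ c ∈ μ, T c < q ∧ a (T c) = content c) ∧
      (∀ c ∈ μ, ∀ c' ∈ μ, c < c' → T c < T c') ∧ Set.InjOn T μ ∧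
      ∀ r ≤ q, ∀ κ, IsPath κ r a → ∀ c, c ∈ κ ↔ c ∈ μ ∧ T c < r := by
  induction h with
  | nil =>
    refine ⟨fun _ => 0, fun c hc => absurd hc (YoungDiagram.notMem_bot c),
      fun c hc => absurd hc (YoungDiagram.notMem_bot c),
      fun c hc => absurd hc (YoungDiagram.notMem_bot c), fun r hr κ hκ c => ?_⟩
    obtain rfl : r = 0 := by omega
    cases hκ
    simp
  | @snoc κ μ q a b h hc hb ih =>
    obtain ⟨T, h1, h2, h3, h4⟩ := ih
    have hT : ∀ c ∈ κ, Function.update T b q c = T c := fun c hcm =>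
      Function.update_of_ne (fun e => hc.1 (by rwa [← e])) _ _
    have hTb : Function.update T b q b = q := Function.update_self _ _ _
    refine ⟨Function.update T b q, fun c hcm => ?_, fun c hcm c' hcm' hlt => ?_,
      fun c hcm c' hcm' he => ?_, fun r hr ν hν c => ?_⟩
    · rcases (hc.2 c).1 hcm with rfl | hm
      · rw [hTb]
        exact ⟨by omega, hb⟩
      · rw [hT c hm]
        exact ⟨by have := (h1 c hm).1; omega, (h1 c hm).2⟩
    · rcases (hc.2 c').1 hcm' with rfl | hm'
      · have hm := hc.mem_of_le hlt.le hlt.ne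
        rw [hT c hm, hTb]
        exact (h1 c hm).1
      · have hm := κ.isLowerSet hlt.le hm'
        rw [hT c hm, hT c' hm']
        exact h2 c hm c' hm' hlt
    · rcases (hc.2 c).1 hcm with rfl | hm <;> rcases (hc.2 c').1 hcm' with rfl | hm'
      · rfl
      · rw [hTb, hT c' hm'] at he
        have := (h1 c' hm').1
        omega
      · rw [hTb, hT c hm] at he
        have := (h1 c hm).1
        omega
      · rw [hT c hm, hT c' hm'] at he
        exact h3 hm hm' he
    · rcases Nat.lt_or_ge q r with hq | hq
      · obtain rfl : r = q + 1 := by omega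
        obtain rfl := hν.unique (.snoc h hc hb)
        refine ⟨fun hm => ⟨hm, ?_⟩, And.left⟩
        rcases (hc.2 c).1 hm with rfl | hm
        · rw [hTb]; omega
        · rw [hT c hm]; have := (h1 c hm).1; omega
      · rw [h4 r hq ν hν c]
        refine ⟨fun hm => ⟨(hc.2 c).2 (Or.inr hm.1), by rw [hT c hm.1]; exact hm.2⟩, fun hm => ?_⟩
        rcases (hc.2 c).1 hm.1 with rfl | hm'
        · have := hm.2
          rw [hTb] at this
          omega
        · exact ⟨hm', by rw [← hT c hm']; exact hm.2⟩

theorem card_sdiff_oneRow {μ : YoungDiagram} {r : ℕ} (h : oneRow r ≤ μ) :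
    (μ.cells \ (oneRow r).cells).card = μ.card - r := by
  rw [Finset.card_sdiff_of_subset (YoungDiagram.cells_subset_iff.2 h)]
  have := card_oneRow r
  rw [YoungDiagram.card] at this
  rw [this]

/-- A content sequence that starts with `0, 1, …, r - 1` gives a standard skew tableau from
which it can be recovered. -/
theorem IsPath.exists_skew {μ : YoungDiagram} {q r : ℕ} {a : ℕ → ℝ} (h : IsPath μ q a)
    (hr : r ≤ q) (ha : ∀ t < r, a t = t) :
    oneRow r ≤ μ ∧ ∃ T : StdSkewTableau μ (oneRow r), ∀ c, a (T.1 c + r) = content c.1 := by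
  obtain ⟨T, h1, h2, h3, h4⟩ := h.exists_tableau
  -- The contents `0, 1, …, r - 1` determine their shape, so the entries below `r` fill exactly
  -- `oneRow r`. Lowering the other entries by `r` gives the skew tableau.
  have hrow : ∀ c, c ∈ oneRow r ↔ c ∈ μ ∧ T c < r :=
    h4 r hr _ ((isPath_oneRow r).congr fun t ht => (ha t ht).symm)
  have hle : oneRow r ≤ μ := fun c hc => ((hrow c).1 hc).1
  have hcard := card_sdiff_oneRow hle
  rw [h.card] at hcard
  have hmem : ∀ c : {c // c ∈ μ.cells \ (oneRow r).cells}, c.1 ∈ μ ∧ r ≤ T c.1 := by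
    rintro ⟨c, hc⟩
    rw [Finset.mem_sdiff, YoungDiagram.mem_cells, YoungDiagram.mem_cells, hrow] at hc
    exact ⟨hc.1, not_lt.1 fun hcon => hc.2 ⟨hc.1, hcon⟩⟩
  let f : {c // c ∈ μ.cells \ (oneRow r).cells} → Fin (μ.cells \ (oneRow r).cells).card :=
    fun c => ⟨T c.1 - r, by have := hmem c; have := (h1 c.1 this.1).1; omega⟩
  have hf : Function.Bijective f := by
    rw [Fintype.bijective_iff_injective_and_card]
    refine ⟨fun c c' he => ?_, by simp only [Fintype.card_coe, Fintype.card_fin]⟩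
    have e := congrArg Fin.val he
    have m1 := hmem c
    have m2 := hmem c'
    simp only [f] at e
    exact Subtype.ext (h3 m1.1 m2.1 (by omega))
  have hlt : ∀ c c' : {c // c ∈ μ.cells \ (oneRow r).cells}, c.1 < c'.1 → f c < f c' := by
    intro c c' hcc
    have m1 := hmem c
    have m2 := hmem c'
    have := h2 _ m1.1 _ m2.1 hcc
    simp only [f, Fin.mk_lt_mk]
    omega
  refine ⟨hle, ⟨Equiv.ofBijective f hf, fun c c' e hl => hlt c c' ?_, fun c c' e hl => hlt c c' ?_⟩,
    fun c => ?_⟩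
  · exact Prod.lt_iff.2 (Or.inr ⟨e.le, hl⟩)
  · exact Prod.lt_iff.2 (Or.inl ⟨hl, e.le⟩)
  · have m1 := hmem c
    rw [Equiv.ofBijective_apply, ← (h1 c.1 m1.1).2]
    simp only [f]
    congr 1
    omega

instance (μ ν : YoungDiagram) : Finite (StdSkewTableau μ ν) :=
  Subtype.finite

/-- Content sequences that start with `0, 1, …, r - 1` are counted by standard skew tableaux. -/
theorem card_le_numSkew {μ : YoungDiagram} {q r : ℕ} (hr : r ≤ q) (K : Finset (ℕ → ℝ))
    (hK : ∀ a ∈ K, IsPath μ q a ∧ ∀ t < r, a t = t)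
    (hout : ∀ a ∈ K, ∀ a' ∈ K, ∀ t, q ≤ t → a t = a' t) :
    K.card ≤ numSkew μ (oneRow r) := by
  rcases K.eq_empty_or_nonempty with rfl | ⟨a₀, ha₀⟩
  · simp
  have hle := ((hK a₀ ha₀).1.exists_skew hr (hK a₀ ha₀).2).1
  choose T hT using fun a : K => ((hK a.1 a.2).1.exists_skew hr (hK a.1 a.2).2).2
  rw [numSkew, if_pos hle, ← Fintype.card_coe, ← Nat.card_eq_fintype_card]
  refine Nat.card_le_card_of_injective T fun a a' he => Subtype.ext (funext fun t => ?_)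
  rcases Nat.lt_or_ge t r with h1 | h1
  · rw [(hK a.1 a.2).2 t h1, (hK a'.1 a'.2).2 t h1]
  rcases Nat.lt_or_ge t q with h2 | h2
  · have hcard := card_sdiff_oneRow hle
    rw [(hK a₀ ha₀).1.card] at hcard
    have e1 := hT a ((T a).1.symm ⟨t - r, by omega⟩)
    have e2 := hT a' ((T a).1.symm ⟨t - r, by omega⟩)
    rw [← he] at e2
    simp only [Equiv.apply_symm_apply, Nat.sub_add_cancel h1] at e1 e2
    rw [e1, e2]
  · exact hout a.1 a.2 a'.1 a'.2 t h2

/-! ### Jucys–Murphy operators -/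

/-- The operators `s 0, …, s (L - 1)` are symmetric involutions that satisfy the Coxeter relations
of the symmetric group on `L + 1` points. -/
structure IsCoxeter {V : Type*} [NormedAddCommGroup V] [InnerProductSpace ℂ V]
    (s : ℕ → V →ₗ[ℂ] V) (L : ℕ) : Prop where
  symm : ∀ i < L, (s i).IsSymmetric
  sq : ∀ i < L, ∀ v, s i (s i v) = v
  comm : ∀ i j, i + 1 < j → j < L → ∀ v, s i (s j v) = s j (s i v)
  braid : ∀ i, i + 1 < L → ∀ v, s i (s (i + 1) (s i v)) = s (i + 1) (s i (s (i + 1) v))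

section JucysMurphy

variable {V : Type*} [NormedAddCommGroup V] [InnerProductSpace ℂ V]

/-- The Jucys–Murphy operators. -/
noncomputable def jm (s : ℕ → V →ₗ[ℂ] V) : ℕ → V →ₗ[ℂ] V
  | 0 => 0
  | i + 1 => s i ∘ₗ jm s i ∘ₗ s i + s i

theorem jm_succ_apply (s : ℕ → V →ₗ[ℂ] V) (i : ℕ) (v : V) :
    jm s (i + 1) v = s i (jm s i (s i v)) + s i v := rfl

/-- The first `Q` Jucys–Murphy operators act on `v` by the scalars `a`. -/
def IsWeight (s : ℕ → V →ₗ[ℂ] V) (Q : ℕ) (v : V) (a : ℕ → ℝ) : Prop :=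
  ∀ t < Q, jm s t v = (a t : ℂ) • v

/-- The intertwining operator that exchanges the entries `i` and `i + 1` of a weight. -/
noncomputable def step (s : ℕ → V →ₗ[ℂ] V) (i : ℕ) (p : V × (ℕ → ℝ)) : V × (ℕ → ℝ) :=
  (((p.2 (i + 1) - p.2 i : ℝ) : ℂ) • s i p.1 - p.1, p.2 ∘ Equiv.swap i (i + 1))

variable {s : ℕ → V →ₗ[ℂ] V} {L : ℕ}

theorem IsCoxeter.comm' (hs : IsCoxeter s L) {i j : ℕ} (hi : i < L) (hj : j < L)
    (h : i + 1 < j ∨ j + 1 < i) (v : V) : s i (s j v) = s j (s i v) := by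
  rcases h with h | h
  · exact hs.comm i j h hj v
  · exact (hs.comm j i h hi v).symm

theorem IsCoxeter.jm_isSymmetric (hs : IsCoxeter s L) {i : ℕ} (hi : i ≤ L) :
    (jm s i).IsSymmetric := by
  induction i with
  | zero => intro x y; simp [jm]
  | succ i ih =>
    intro x y
    rw [jm_succ_apply, jm_succ_apply, inner_add_left, inner_add_right, hs.symm i hi, ih (by omega),
      hs.symm i hi, hs.symm i hi]

theorem IsCoxeter.jm_comm_of_lt (hs : IsCoxeter s L) {i j : ℕ} (hj : j < L) (hij : i < j) (v : V) :
    s j (jm s i v) = jm s i (s j v) := by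
  induction i generalizing v with
  | zero => simp [jm]
  | succ i ih =>
    rw [jm_succ_apply, jm_succ_apply, map_add, ← hs.comm i j hij hj, ih (by omega),
      ← hs.comm i j hij hj]

/-- The critical case is `i = j + 2`: there `jm s i` unfolds to a conjugate of `jm s j` by `s (j +
1)` and `s j` plus two further terms, and the braid relation carries `s j` through. Larger `i`
follow by commutation. -/
theorem IsCoxeter.jm_comm_gen (hs : IsCoxeter s L) {i j : ℕ} (hj : j < L) (hi : i ≤ L)
    (h1 : j ≠ i) (h2 : j + 1 ≠ i) (v : V) : s j (jm s i v) = jm s i (s j v) := by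
  rcases Nat.lt_or_ge i j with h3 | h3
  · exact hs.jm_comm_of_lt hj h3 v
  induction i generalizing v with
  | zero => omega
  | succ i ih =>
    by_cases h4 : j + 1 = i
    · subst h4
      have e1 := hs.braid j (by omega)
      have e2 := hs.jm_comm_of_lt (i := j) (j := j + 1) (by omega) (by omega)
      have e3 := hs.sq j (by omega)
      have e4 := hs.sq (j + 1) (by omega)
      simp only [jm_succ_apply, map_add]
      rw [e1, e2, e1, e4, ← e1 (s j v), e3, add_right_comm, ← e1 v]
    · rw [jm_succ_apply, jm_succ_apply, map_add, hs.comm' hj (by omega) (by omega),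
        ih (by omega) (by omega) h4 _ (by omega), hs.comm' hj (by omega) (by omega)]

theorem IsCoxeter.jm_comm (hs : IsCoxeter s L) {i j : ℕ} (hi : i ≤ L) (hj : j ≤ L) (v : V) :
    jm s i (jm s j v) = jm s j (jm s i v) := by
  have key : ∀ i j, i < j → j ≤ L → ∀ v, jm s i (jm s j v) = jm s j (jm s i v) := by
    intro i j hij hj
    induction i with
    | zero => intro v; simp [jm]
    | succ i ih =>
      intro v
      rw [jm_succ_apply, jm_succ_apply, map_add,
        hs.jm_comm_gen (by omega) hj (by omega) (by omega), ih (by omega),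
        hs.jm_comm_gen (by omega) hj (by omega) (by omega)]
  rcases lt_trichotomy i j with h | rfl | h
  · exact key i j h hj v
  · rfl
  · exact (key j i h hi v).symm

theorem IsCoxeter.jm_gen (hs : IsCoxeter s L) {i : ℕ} (hi : i < L) (v : V) :
    jm s i (s i v) = s i (jm s (i + 1) v) - v := by
  rw [jm_succ_apply, map_add, hs.sq i hi, hs.sq i hi, add_sub_cancel_right]

theorem IsCoxeter.jm_succ_gen (hs : IsCoxeter s L) {i : ℕ} (hi : i < L) (v : V) :
    jm s (i + 1) (s i v) = s i (jm s i v) + v := by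
  rw [jm_succ_apply, hs.sq i hi]

/-! ### Weights and the intertwining operators -/

open scoped InnerProductSpace

/-- This is the relation `jm_gen` paired with `v`. It forces consecutive entries of a weight to
differ and yields the norm of the intertwined vector. -/
theorem IsWeight.inner_gen (hs : IsCoxeter s L) {Q : ℕ} {v : V} {a : ℕ → ℝ}
    (h : IsWeight s Q v a) (hQ : Q ≤ L + 1) {i : ℕ} (hi : i + 1 < Q) :
    ((a (i + 1) - a i : ℝ) : ℂ) * ⟪v, s i v⟫_ℂ = ⟪v, v⟫_ℂ := by
  have e1 : ⟪v, jm s i (s i v)⟫_ℂ = a i * ⟪v, s i v⟫_ℂ := by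
    rw [← hs.jm_isSymmetric (by omega), h i (by omega), inner_smul_left, Complex.conj_ofReal]
  rw [hs.jm_gen (by omega), h (i + 1) hi, map_smul, inner_sub_right, inner_smul_right] at e1
  push_cast
  linear_combination e1

/-- The factor is the squared difference of the two entries minus one; by definiteness the operator
kills a weight vector exactly when the entries differ by one. -/
theorem IsWeight.step_inner (hs : IsCoxeter s L) {Q : ℕ} {v : V} {a : ℕ → ℝ}
    (h : IsWeight s Q v a) (hQ : Q ≤ L + 1) {i : ℕ} (hi : i + 1 < Q) :
    ⟪(step s i (v, a)).1, (step s i (v, a)).1⟫_ℂ =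
      (((a (i + 1) - a i : ℝ) : ℂ) ^ 2 - 1) * ⟪v, v⟫_ℂ := by
  have e1 := h.inner_gen hs hQ hi
  have e2 : ⟪s i v, v⟫_ℂ = ⟪v, s i v⟫_ℂ := hs.symm i (by omega) v v
  have e3 : ⟪s i v, s i v⟫_ℂ = ⟪v, v⟫_ℂ := by rw [hs.symm i (by omega), hs.sq i (by omega)]
  simp only [step, inner_sub_left, inner_sub_right, inner_smul_left, inner_smul_right,
    Complex.conj_ofReal, e2, e3]
  linear_combination (-2) * e1

theorem IsWeight.ne_of_ne_zero (hs : IsCoxeter s L) {Q : ℕ} {v : V} {a : ℕ → ℝ}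
    (h : IsWeight s Q v a) (hQ : Q ≤ L + 1) (hv : v ≠ 0) {i : ℕ} (hi : i + 1 < Q) :
    a (i + 1) ≠ a i := by
  intro he
  have := h.inner_gen hs hQ hi
  rw [he, sub_self, Complex.ofReal_zero, zero_mul] at this
  exact hv (inner_self_eq_zero.1 this.symm)

theorem IsWeight.step_eq_zero_iff (hs : IsCoxeter s L) {Q : ℕ} {v : V} {a : ℕ → ℝ}
    (h : IsWeight s Q v a) (hQ : Q ≤ L + 1) (hv : v ≠ 0) {i : ℕ} (hi : i + 1 < Q) :
    (step s i (v, a)).1 = 0 ↔ a (i + 1) = a i + 1 ∨ a (i + 1) = a i - 1 := by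
  rw [← inner_self_eq_zero (𝕜 := ℂ), h.step_inner hs hQ hi, mul_eq_zero,
    or_iff_left (inner_self_eq_zero.not.2 hv)]
  have : (((a (i + 1) - a i : ℝ) : ℂ) ^ 2 - 1 = 0) ↔
      (a (i + 1) - a i - 1) * (a (i + 1) - a i + 1) = 0 := by
    rw [← Complex.ofReal_inj]
    push_cast
    ring_nf
  rw [this, mul_eq_zero]
  constructor <;> rintro (h | h)
  · left; linarith
  · right; linarith
  · left; linarith
  · right; linarith

/-- Up to the correction terms in `jm_gen` and `jm_succ_gen`, `s i` exchanges `jm s i` and `jm s (i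
+ 1)`. Scaling by the difference of the entries and subtracting `v` cancels the corrections. -/
theorem IsWeight.step (hs : IsCoxeter s L) {Q : ℕ} {p : V × (ℕ → ℝ)}
    (h : IsWeight s Q p.1 p.2) (hQ : Q ≤ L + 1) {i : ℕ} (hi : i + 1 < Q) :
    IsWeight s Q (step s i p).1 (step s i p).2 := by
  obtain ⟨v, a⟩ := p
  intro t ht
  simp only [TabloidFFT.step, Function.comp_apply]
  simp only at h
  by_cases h1 : t = i
  · subst h1
    rw [Equiv.swap_apply_left, map_sub, map_smul, hs.jm_gen (by omega), h _ hi, h t (by omega),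
      map_smul]
    push_cast
    module
  by_cases h2 : t = i + 1
  · subst h2
    rw [Equiv.swap_apply_right, map_sub, map_smul, hs.jm_succ_gen (by omega), h _ hi,
      h i (by omega), map_smul]
    push_cast
    module
  rw [Equiv.swap_apply_of_ne_of_ne h1 h2, map_sub, map_smul,
    ← hs.jm_comm_gen (by omega) (by omega) (Ne.symm h1) (Ne.symm h2), h t ht, map_smul]
  module

/-! ### Weights are content sequences -/

theorem IsWeight.mono {Q Q' : ℕ} {v : V} {a a' : ℕ → ℝ} (h : IsWeight s Q v a) (hQ : Q' ≤ Q)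
    (haa : ∀ t < Q', a t = a' t) : IsWeight s Q' v a' := fun t ht => by
  rw [h t (by omega), haa t ht]

/-- A weight does not contain the entries `c, c ± 1, c` in succession. -/
theorem IsWeight.ne_succ_succ (hs : IsCoxeter s L) {Q : ℕ} {v : V} {a : ℕ → ℝ}
    (h : IsWeight s Q v a) (hQ : Q ≤ L + 1) (hv : v ≠ 0) {i : ℕ} (hi : i + 2 < Q)
    (h1 : a (i + 1) = a i + 1 ∨ a (i + 1) = a i - 1) : a (i + 2) ≠ a i := by
  intro h2
  -- Both intertwining operators kill `v`, so `s i` and `s (i + 1)` act on it by opposite signs, and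
  -- the braid relation gives `v = -v`.
  have e1 := (h.step_eq_zero_iff hs hQ hv (by omega)).2 h1
  have e2 := (h.step_eq_zero_iff hs hQ hv (i := i + 1) (by omega)).2 (by
    rw [show i + 1 + 1 = i + 2 from rfl, h2]
    rcases h1 with h1 | h1
    · right; linarith
    · left; linarith)
  have hb := hs.braid i (by omega) v
  simp only [TabloidFFT.step, show i + 1 + 1 = i + 2 from rfl, h2] at e1 e2
  have key : v + v = 0 := by
    rcases h1 with h1 | h1
    · rw [h1] at e1 e2
      have f1 : s i v = v := by
        rw [← sub_eq_zero, ← e1]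
        push_cast
        module
      have f2 : s (i + 1) v = -v := by
        rw [← sub_eq_zero, ← neg_eq_zero, ← e2]
        push_cast
        module
      simp only [f1, f2, map_neg, neg_neg] at hb
      rw [← sub_eq_zero, ← neg_eq_zero] at hb
      rw [← hb]
      module
    · rw [h1] at e1 e2
      have f1 : s i v = -v := by
        rw [← sub_eq_zero, ← neg_eq_zero, ← e1]
        push_cast
        module
      have f2 : s (i + 1) v = v := by
        rw [← sub_eq_zero, ← e2]
        push_cast
        module
      simp only [f1, f2, map_neg, neg_neg] at hb
      rw [← sub_eq_zero] at hb
      rw [← hb]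
      module
  have : (2 : ℂ) • v = 0 := by rw [two_smul, key]
  exact hv ((smul_eq_zero.1 this).resolve_left two_ne_zero)

theorem swap_comp_of_lt {a : ℕ → ℝ} {i t : ℕ} (h : t < i ∨ i + 1 < t) :
    (a ∘ Equiv.swap i (i + 1)) t = a t := by
  rw [Function.comp_apply, Equiv.swap_apply_of_ne_of_ne (by omega) (by omega)]

/-- A removable cell of the shape can be made the position of the last entry. -/
theorem IsWeight.exists_bubble (hs : IsCoxeter s L) {Q : ℕ} (hQ : Q ≤ L + 1) {κ : YoungDiagram}
    {q : ℕ} {a : ℕ → ℝ} {v : V} (hw : IsWeight s Q v a) (hv : v ≠ 0) (hq : q ≤ Q)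
    (h : IsPath κ q a) {β : ℕ × ℕ} {ν : YoungDiagram} (hβ : AddCell ν β κ) :
    ∃ w a' q', w ≠ 0 ∧ IsWeight s Q w a' ∧ (∀ t, q ≤ t → a' t = a t) ∧ q = q' + 1 ∧
      IsPath ν q' a' ∧ a' q' = content β := by
  induction h generalizing β ν with
  | nil => exact absurd ((hβ.2 β).2 (Or.inl rfl)) (YoungDiagram.notMem_bot _)
  | @snoc lam κ q a b h hc hb ih =>
    by_cases hne : b = β
    · subst hne
      have : ν = lam := SetLike.ext fun c => by
        have := (hc.2 c).symm.trans (hβ.2 c)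
        by_cases hcb : c = b
        · subst hcb
          exact ⟨fun hm => absurd hm hβ.1, fun hm => absurd hm hc.1⟩
        · tauto
      subst this
      exact ⟨v, a, q, hv, hw, fun _ _ => rfl, rfl, h, hb⟩
    -- The cell `β` is also removable before `b` is added, so it can be brought to the place just
    -- before `b`. Both cells can be added to `κ'`, so their contents differ by at least two and the
    -- final exchange does not kill the vector.
    · obtain ⟨κ', e1, e2⟩ := hc.exists_neither hβ hne
      obtain ⟨w, a', q', hw0, hw', haa, rfl, hp, hq'⟩ := ih hw (by omega) e1
      have hd := e1.content_sub e2 (Ne.symm hne)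
      have ha1 : a' (q' + 1) = content b := by rw [haa _ le_rfl, hb]
      refine ⟨(TabloidFFT.step s q' (w, a')).1, (TabloidFFT.step s q' (w, a')).2, q' + 1, ?_,
        IsWeight.step hs (p := (w, a')) hw' hQ (by omega), fun t ht => ?_, rfl, ?_, ?_⟩
      · rw [Ne, hw'.step_eq_zero_iff hs hQ hw0 (by omega), ha1, hq']
        rintro (h | h) <;> rcases hd with hd | hd <;> linarith
      · exact (swap_comp_of_lt (by omega)).trans (haa t (by omega))
      · refine .snoc (hp.congr fun t ht => (swap_comp_of_lt (by omega)).symm) e2 ?_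
        simp only [TabloidFFT.step, Function.comp_apply, Equiv.swap_apply_left, ha1]
      · simp only [TabloidFFT.step, Function.comp_apply, Equiv.swap_apply_right, hq']

/-- Every weight is the content sequence of a standard tableau. -/
theorem IsWeight.exists_isPath (hs : IsCoxeter s L) {q : ℕ} (hq : q ≤ L + 1) {v : V} {a : ℕ → ℝ}
    (hw : IsWeight s q v a) (hv : v ≠ 0) : ∃ μ, IsPath μ q a := by
  induction q generalizing v a with
  | zero => exact ⟨_, .nil _⟩
  | succ q ih =>
    rcases q with _ | q
    · obtain ⟨μ, hμ⟩ := exists_addCell (κ := ⊥) (b := (0, 0)) (YoungDiagram.notMem_bot _)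
        fun c hc hne => absurd (le_antisymm hc ⟨Nat.zero_le _, Nat.zero_le _⟩) hne
      refine ⟨μ, .snoc (.nil _) hμ ?_⟩
      have h0 := hw 0 (by omega)
      simp only [jm, LinearMap.zero_apply] at h0
      have := (smul_eq_zero.1 h0.symm).resolve_right hv
      rw [Complex.ofReal_eq_zero] at this
      rw [this]
      simp [content]
    · obtain ⟨lam, hlam⟩ := ih (by omega) (hw.mono (by omega) fun _ _ => rfl) hv
      obtain ⟨κ, b, hκ, hb, hbc⟩ := hlam.exists_snoc
      suffices hsuff : ∃ b' μ, AddCell lam b' μ ∧ a (q + 1) = content b' by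
        obtain ⟨b', μ, h1, h2⟩ := hsuff
        exact ⟨μ, .snoc hlam h1 h2⟩
      -- If `κ` has a removable cell whose content is the new entry, moving that cell to the end of
      -- `κ` produces the forbidden succession `c, c ± 1, c`.
      have hcontra : ∀ β, content β = a (q + 1) → content β = a q + 1 ∨ content β = a q - 1 →
          (∃ ν, AddCell ν β κ) → False := by
        rintro β h1 h2 ⟨ν, hν⟩
        obtain ⟨w, a', q', hw0, hw', haa, rfl, hp, hq'⟩ :=
          hw.exists_bubble hs hq hv (by omega) hκ hν
        refine hw'.ne_succ_succ hs hq hw0 (i := q') (by omega) ?_ ?_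
        · rw [haa _ le_rfl, hq']
          rcases h2 with h2 | h2
          · right; linarith
          · left; linarith
        · rw [haa (q' + 2) (by omega), hq', h1]
      by_cases h1 : a (q + 1) = a q + 1
      · obtain ⟨i, j⟩ := b
        by_cases h2 : ∃ μ, AddCell lam (i, j + 1) μ
        · obtain ⟨μ, hμ⟩ := h2
          refine ⟨_, μ, hμ, ?_⟩
          rw [h1, hbc]
          simp only [content]
          push_cast
          ring
        -- The right neighbour of `b` is blocked only by a missing cell above it. Then the cell
        -- above `b` is a removable corner of `κ`, and its content is the new entry.
        · exfalso
          have hij : (i, j) ∈ lam := (hb.2 _).2 (Or.inl rfl)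
          have hn1 : (i, j + 1) ∉ lam := by
            intro hm
            rcases (hb.2 _).1 hm with h | h
            · simp at h
            · exact hb.1 (κ.up_left_mem le_rfl (Nat.le_succ j) h)
          have hn2 : ¬ (i = 0 ∨ (i - 1, j + 1) ∈ lam) := by
            intro hor
            apply h2
            refine exists_addCell hn1 ?_
            rintro ⟨c1, c2⟩ ⟨hc1, hc2⟩ hne
            simp only at hc1 hc2
            simp only [ne_eq, Prod.mk.injEq] at hne
            by_cases hc3 : c2 ≤ j
            · exact lam.up_left_mem hc1 hc3 hij
            · rcases hor with rfl | hm
              · omega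
              · exact lam.up_left_mem (by omega) hc2 hm
          push Not at hn2
          obtain ⟨i, rfl⟩ := Nat.exists_eq_succ_of_ne_zero hn2.1
          simp only [Nat.succ_eq_add_one, Nat.add_sub_cancel] at hn2 hb hbc
          refine hcontra (i, j) ?_ (Or.inl ?_) (exists_removeCell ?_ hb.1 ?_)
          · rw [h1, hbc]; simp only [content]; push_cast; ring
          · rw [hbc]; simp only [content]; push_cast; ring
          · exact hb.mem_of_le ⟨Nat.le_succ i, le_rfl⟩ (by simp)
          · exact fun hm => hn2.2 ((hb.2 _).2 (Or.inr hm))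
      by_cases h1' : a (q + 1) = a q - 1
      · obtain ⟨i, j⟩ := b
        by_cases h2 : ∃ μ, AddCell lam (i + 1, j) μ
        · obtain ⟨μ, hμ⟩ := h2
          refine ⟨_, μ, hμ, ?_⟩
          rw [h1', hbc]
          simp only [content]
          push_cast
          ring
        -- The transposed situation: the cell to the left of `b` is a removable corner of `κ`.
        · exfalso
          have hij : (i, j) ∈ lam := (hb.2 _).2 (Or.inl rfl)
          have hn1 : (i + 1, j) ∉ lam := by
            intro hm
            rcases (hb.2 _).1 hm with h | h
            · simp at h
            · exact hb.1 (κ.up_left_mem (Nat.le_succ i) le_rfl h)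
          have hn2 : ¬ (j = 0 ∨ (i + 1, j - 1) ∈ lam) := by
            intro hor
            apply h2
            refine exists_addCell hn1 ?_
            rintro ⟨c1, c2⟩ ⟨hc1, hc2⟩ hne
            simp only at hc1 hc2
            simp only [ne_eq, Prod.mk.injEq] at hne
            by_cases hc3 : c1 ≤ i
            · exact lam.up_left_mem hc3 hc2 hij
            · rcases hor with rfl | hm
              · omega
              · exact lam.up_left_mem hc1 (by omega) hm
          push Not at hn2
          obtain ⟨j, rfl⟩ := Nat.exists_eq_succ_of_ne_zero hn2.1
          simp only [Nat.succ_eq_add_one, Nat.add_sub_cancel] at hn2 hb hbc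
          refine hcontra (i, j) ?_ (Or.inr ?_) (exists_removeCell ?_ ?_ hb.1)
          · rw [h1', hbc]; simp only [content]; push_cast; ring
          · rw [hbc]; simp only [content]; push_cast; ring
          · exact hb.mem_of_le ⟨le_rfl, Nat.le_succ j⟩ (by simp)
          · exact fun hm => hn2.2 ((hb.2 _).2 (Or.inr hm))
      -- Exchange the last two entries: by induction the new entry is the content of a cell addable
      -- to `κ`. It differs from `b`, so it can still be added after `b`.
      · have hw' := IsWeight.step hs (p := (v, a)) hw hq (i := q) (by omega)
        have hv' : (TabloidFFT.step s q (v, a)).1 ≠ 0 := by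
          rw [Ne, hw.step_eq_zero_iff hs hq hv (by omega)]
          tauto
        obtain ⟨lam', hlam'⟩ := ih (by omega) (hw'.mono (by omega) fun _ _ => rfl) hv'
        obtain ⟨κ', b', hκ', hb', hbc'⟩ := hlam'.exists_snoc
        obtain rfl := (hκ'.congr fun t ht => swap_comp_of_lt (by omega)).unique hκ
        simp only [TabloidFFT.step, Function.comp_apply, Equiv.swap_apply_left] at hbc'
        have hne : b ≠ b' := by
          rintro rfl
          exact hw.ne_of_ne_zero hs hq hv (by omega) (hbc'.trans hbc.symm)
        obtain ⟨μ, e1, -⟩ := hb.exists_both hb' hne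
        exact ⟨b', μ, e1, hbc'⟩

end JucysMurphy

/-- The vectors fixed by the generators of the symmetric group on the first `r` points. -/
def fixedVectors {V : Type*} [AddCommGroup V] [Module ℂ V] (s : ℕ → V →ₗ[ℂ] V) (r : ℕ) :
    Submodule ℂ V where
  carrier := {v | ∀ i, i + 1 < r → s i v = v}
  add_mem' := fun h h' i hi => by rw [map_add, h i hi, h' i hi]
  zero_mem' := fun i _ => map_zero _
  smul_mem' := fun c v h i hi => by rw [map_smul, h i hi]

/-! ### Words in the intertwining operators -/

section NormalForms

variable {V : Type*} [NormedAddCommGroup V] [InnerProductSpace ℂ V]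
  {s : ℕ → V →ₗ[ℂ] V} {L : ℕ}

theorem step_smul (i : ℕ) (c : ℂ) (p : V × (ℕ → ℝ)) :
    step s i (c • p.1, p.2) = (c • (step s i p).1, (step s i p).2) := by
  simp only [step, map_smul, Prod.mk.injEq, and_true]
  module

theorem IsCoxeter.step_step (hs : IsCoxeter s L) {i : ℕ} (hi : i < L) (p : V × (ℕ → ℝ)) :
    step s i (step s i p) = ((1 - ((p.2 (i + 1) - p.2 i : ℝ) : ℂ) ^ 2) • p.1, p.2) := by
  simp only [step, Function.comp_apply, Equiv.swap_apply_left, Equiv.swap_apply_right, map_sub,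
    map_smul, hs.sq i hi, Prod.mk.injEq]
  refine ⟨?_, ?_⟩
  · push_cast
    module
  · ext t
    simp

theorem IsCoxeter.step_comm (hs : IsCoxeter s L) {i j : ℕ} (hi : i < L) (hj : j < L)
    (hij : i + 1 < j ∨ j + 1 < i) (p : V × (ℕ → ℝ)) :
    step s i (step s j p) = step s j (step s i p) := by
  simp only [step, Function.comp_apply, map_sub, map_smul, hs.comm' hi hj hij, Prod.mk.injEq]
  rw [Equiv.swap_apply_of_ne_of_ne (show i + 1 ≠ j by omega) (by omega),
    Equiv.swap_apply_of_ne_of_ne (show i ≠ j by omega) (by omega),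
    Equiv.swap_apply_of_ne_of_ne (show j + 1 ≠ i by omega) (by omega),
    Equiv.swap_apply_of_ne_of_ne (show j ≠ i by omega) (by omega)]
  refine ⟨by module, ?_⟩
  ext t
  simp only [Function.comp_apply, Equiv.swap_apply_def]
  grind

theorem IsCoxeter.step_braid (hs : IsCoxeter s L) {i : ℕ} (hi : i + 1 < L) (p : V × (ℕ → ℝ)) :
    step s i (step s (i + 1) (step s i p)) = step s (i + 1) (step s i (step s (i + 1) p)) := by
  obtain ⟨v, a⟩ := p
  have w1 : Equiv.swap i (i + 1) (i + 2) = i + 2 :=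
    Equiv.swap_apply_of_ne_of_ne (by omega) (by omega)
  have w2 : Equiv.swap (i + 1) (i + 2) i = i :=
    Equiv.swap_apply_of_ne_of_ne (by omega) (by omega)
  simp only [step, Function.comp_apply, map_sub, map_smul, hs.sq i (by omega), hs.sq (i + 1) hi,
    hs.braid i hi, Prod.mk.injEq, show i + 1 + 1 = i + 2 from rfl, Equiv.swap_apply_left,
    Equiv.swap_apply_right, w1, w2]
  refine ⟨?_, ?_⟩
  · push_cast
    module
  · ext t
    simp only [Function.comp_apply, Equiv.swap_apply_def]
    grind

/-- Applies the intertwining operators `k, k - 1, …` (`j` of them). -/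
noncomputable def descend (s : ℕ → V →ₗ[ℂ] V) (k : ℕ) : ℕ → V × (ℕ → ℝ) → V × (ℕ → ℝ)
  | 0, q => q
  | j + 1, q => step s (k - j) (descend s k j q)

theorem descend_smul (k j : ℕ) (c : ℂ) (p : V × (ℕ → ℝ)) :
    descend s k j (c • p.1, p.2) = (c • (descend s k j p).1, (descend s k j p).2) := by
  induction j with
  | zero => rfl
  | succ j ih => rw [descend, ih, step_smul, descend]

theorem IsCoxeter.step_descend_low (hs : IsCoxeter s L) {i k j : ℕ} (hk : k < L)
    (hij : i + j < k) (p : V × (ℕ → ℝ)) :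
    step s i (descend s k j p) = descend s k j (step s i p) := by
  induction j with
  | zero => rfl
  | succ j ih => rw [descend, hs.step_comm (by omega) (by omega) (by omega), ih (by omega), descend]

/-- The operator commutes with the run until it meets the factors `i + 1` and `i`; there the braid
relation lets it pass with its index lowered by one. -/
theorem IsCoxeter.step_descend_high (hs : IsCoxeter s L) {i k j : ℕ} (hk : k < L) (hj : j ≤ k + 1)
    (hi : i < k) (hij : k < i + j) (p : V × (ℕ → ℝ)) :
    step s (i + 1) (descend s k j p) = descend s k j (step s i p) := by
  induction j with
  | zero => omega
  | succ j ih =>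
    rw [descend, descend]
    rcases Nat.lt_or_ge k (i + j) with h | h
    · rw [hs.step_comm (by omega) (by omega) (by omega), ih (by omega) h]
    · obtain ⟨j, rfl⟩ : ∃ j', j = j' + 1 := ⟨j - 1, by omega⟩
      rw [descend, descend, show k - (j + 1) = i by omega, show k - j = i + 1 by omega,
        ← hs.step_braid (by omega), hs.step_descend_low hk (by omega)]

/-- The results of applying the words `(s_{m₀}) (s_{m₁} s_{m₁ + 1}) ⋯` in normal form that involve
the first `k` operators. -/
inductive NormalForm (s : ℕ → V →ₗ[ℂ] V) (p : V × (ℕ → ℝ)) : ℕ → V × (ℕ → ℝ) → Prop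
  | base : NormalForm s p 0 p
  | descend {k j : ℕ} {q : V × (ℕ → ℝ)} : NormalForm s p k q → j ≤ k + 1 →
      NormalForm s p (k + 1) (descend s k j q)

variable {p : V × (ℕ → ℝ)}

theorem NormalForm.self (s : ℕ → V →ₗ[ℂ] V) (p : V × (ℕ → ℝ)) (k : ℕ) : NormalForm s p k p := by
  induction k with
  | zero => exact .base
  | succ k ih => exact .descend (j := 0) ih (Nat.zero_le _)

/-- Against the run `k, k - 1, …, k - j + 1`, the operator `i` passes unchanged, lengthens the run,
cancels its last factor up to a scalar, or passes with index `i - 1`. In the first and last cases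
induction applies to the shorter word. -/
theorem NormalForm.exists_step (hs : IsCoxeter s L) {k : ℕ} (hk : k ≤ L) {q : V × (ℕ → ℝ)}
    (h : NormalForm s p k q) {i : ℕ} (hi : i < k) :
    ∃ (c : ℂ) (q' : V × (ℕ → ℝ)), NormalForm s p k q' ∧ step s i q = (c • q'.1, q'.2) := by
  induction h generalizing i with
  | base => omega
  | @descend k j q h hj ih =>
    by_cases h1 : i + j < k
    · obtain ⟨c, q', h2, h3⟩ := ih (by omega) (show i < k by omega)
      exact ⟨c, _, .descend h2 hj, by rw [hs.step_descend_low (by omega) h1, h3, descend_smul]⟩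
    by_cases h1' : i + j = k
    · refine ⟨1, _, .descend (j := j + 1) h (by omega), ?_⟩
      rw [TabloidFFT.descend, show k - j = i by omega, one_smul]
    by_cases h1'' : i + j = k + 1
    · obtain ⟨j, rfl⟩ : ∃ j', j = j' + 1 := ⟨j - 1, by omega⟩
      exact ⟨_, _, .descend (j := j) h (by omega), by
        rw [TabloidFFT.descend, show k - j = i by omega, hs.step_step (by omega)]⟩
    · obtain ⟨i, rfl⟩ : ∃ i', i = i' + 1 := ⟨i - 1, by omega⟩
      obtain ⟨c, q', h2, h3⟩ := ih (by omega) (show i < k by omega)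
      exact ⟨c, _, .descend h2 hj, by
        rw [hs.step_descend_high (by omega) hj (by omega) (by omega), h3, descend_smul]⟩

theorem descend_induction {C : V × (ℕ → ℝ) → Prop} {k : ℕ}
    (hstep : ∀ i ≤ k, ∀ q, C q → C (step s i q)) {q : V × (ℕ → ℝ)} (hq : C q) (j : ℕ) :
    C (descend s k j q) := by
  induction j with
  | zero => exact hq
  | succ j ih => exact hstep _ (by omega) _ ih

theorem NormalForm.step_induction {C : V × (ℕ → ℝ) → Prop} {k : ℕ} {q : V × (ℕ → ℝ)}
    (h : NormalForm s p k q) (hp : C p) (hstep : ∀ i < k, ∀ q, C q → C (step s i q)) : C q := by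
  induction h with
  | base => exact hp
  | descend h hj ih =>
    exact descend_induction (fun i hi => hstep i (by omega))
      (ih fun i hi => hstep i (by omega)) _

theorem NormalForm.isWeight (hs : IsCoxeter s L) {k : ℕ} (hk : k ≤ L) {q : V × (ℕ → ℝ)}
    (h : NormalForm s p k q) (hp : IsWeight s (L + 1) p.1 p.2) : IsWeight s (L + 1) q.1 q.2 :=
  h.step_induction (C := fun q => IsWeight s (L + 1) q.1 q.2) hp
    fun _ hi _ hq => hq.step hs le_rfl (by omega)

theorem NormalForm.weight_eq {k : ℕ} {q : V × (ℕ → ℝ)}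
    (h : NormalForm s p k q) {t : ℕ} (ht : k < t) : q.2 t = p.2 t :=
  h.step_induction (C := fun q => q.2 t = p.2 t) rfl
    fun _ _ _ hq => (swap_comp_of_lt (by omega)).trans hq

/-- The run carries the entry at `k + 1` leftwards past `j` others. Each of these must differ from
it, since consecutive entries of the weight of a nonzero vector are distinct. -/
theorem descend_ne_zero (hs : IsCoxeter s L) {k j : ℕ} (hk : k < L) (hj : j ≤ k + 1)
    {q : V × (ℕ → ℝ)} (hq : IsWeight s (L + 1) q.1 q.2) (h0 : (descend s k j q).1 ≠ 0) :
    q.1 ≠ 0 ∧ (descend s k j q).2 (k + 1 - j) = q.2 (k + 1) ∧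
      (∀ t, t < k + 1 - j → (descend s k j q).2 t = q.2 t) ∧
      (∀ t, k + 1 - j ≤ t → t ≤ k → q.2 t ≠ q.2 (k + 1) ∧ (descend s k j q).2 (t + 1) = q.2 t) := by
  induction j with
  | zero => exact ⟨h0, rfl, fun _ _ => rfl, fun t h1 h2 => by omega⟩
  | succ j ih =>
    set q' := descend s k j q with hq'
    have hw : IsWeight s (L + 1) q'.1 q'.2 := descend_induction
      (C := fun q => IsWeight s (L + 1) q.1 q.2) (fun i hi _ h => h.step hs le_rfl (by omega)) hq j
    have h0' : q'.1 ≠ 0 := by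
      intro e
      apply h0
      rw [descend, ← hq', TabloidFFT.step, e, map_zero, smul_zero, sub_zero]
    obtain ⟨e1, e2, e3, e4⟩ := ih (by omega) h0'
    have hne := hw.ne_of_ne_zero hs le_rfl h0' (i := k - j) (by omega)
    have hkj : k - j + 1 = k + 1 - j := by omega
    have hd : (descend s k (j + 1) q).2 = q'.2 ∘ Equiv.swap (k - j) (k - j + 1) := rfl
    rw [hd, show k + 1 - (j + 1) = k - j by omega]
    refine ⟨e1, ?_, fun t ht => ?_, fun t h1 h2 => ?_⟩
    · rw [Function.comp_apply, Equiv.swap_apply_left, hkj, e2]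
    · rw [swap_comp_of_lt (by omega), e3 t (by omega)]
    · by_cases ht : t = k - j
      · subst ht
        rw [Function.comp_apply, Equiv.swap_apply_right, e3 _ (by omega)]
        rw [hkj, e2, e3 _ (by omega)] at hne
        exact ⟨hne.symm, rfl⟩
      · rw [swap_comp_of_lt (by omega)]
        exact e4 t (by omega) h2

/-- Nonzero normal forms are determined by their weights. -/
theorem NormalForm.eq_of_weight_eq (hs : IsCoxeter s L) (hp : IsWeight s (L + 1) p.1 p.2) {k : ℕ}
    (hk : k ≤ L) {q q' : V × (ℕ → ℝ)} (h : NormalForm s p k q) (h' : NormalForm s p k q')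
    (h0 : q.1 ≠ 0) (h0' : q'.1 ≠ 0) (he : q.2 = q'.2) : q = q' := by
  induction h generalizing q' with
  | base => cases h'; rfl
  | @descend k j q h hj ih =>
    cases h' with
    | @descend _ j' q' h' hj' =>
      obtain ⟨a1, a2, a3, a4⟩ := descend_ne_zero hs (by omega) hj (h.isWeight hs (by omega) hp) h0
      obtain ⟨b1, b2, b3, b4⟩ :=
        descend_ne_zero hs (by omega) hj' (h'.isWeight hs (by omega) hp) h0'
      have hl : q.2 (k + 1) = q'.2 (k + 1) := by
        rw [h.weight_eq (by omega), h'.weight_eq (by omega)]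
      -- The length of the run is visible in the weight: `k + 1 - j` is the last position up to `k +
      -- 1` that holds the value originally at `k + 1`.
      have hjj : j = j' := by
        rcases lt_trichotomy j j' with hlt | heq | hlt
        · exfalso
          obtain ⟨c1, c2⟩ := b4 (k - j) (by omega) (by omega)
          rw [show k - j + 1 = k + 1 - j by omega, ← he, a2] at c2
          exact c1 (c2.symm.trans hl)
        · exact heq
        · exfalso
          obtain ⟨c1, c2⟩ := a4 (k - j') (by omega) (by omega)
          rw [show k - j' + 1 = k + 1 - j' by omega, he, b2] at c2
          exact c1 (c2.symm.trans hl.symm)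
      subst hjj
      rw [ih (by omega) h' a1 b1 (funext fun t => ?_)]
      rcases Nat.lt_or_ge t (k + 1 - j) with ht | ht
      · rw [← a3 t ht, ← b3 t ht, he]
      rcases Nat.lt_or_ge k t with ht' | ht'
      · rw [h.weight_eq (by omega), h'.weight_eq (by omega)]
      · rw [← (a4 t ht ht').2, ← (b4 t ht ht').2, he]

theorem NormalForm.finite (s : ℕ → V →ₗ[ℂ] V) (p : V × (ℕ → ℝ)) (k : ℕ) :
    {q | NormalForm s p k q}.Finite := by
  induction k with
  | zero =>
    refine (Set.finite_singleton p).subset fun q hq => ?_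
    cases hq
    rfl
  | succ k ih =>
    refine ((Set.finite_Iic (k + 1)).biUnion fun j _ => ih.image (TabloidFFT.descend s k j)).subset
      fun q hq => ?_
    cases hq with
    | descend h hj => exact Set.mem_biUnion (Set.mem_Iic.2 hj) ⟨_, h, rfl⟩

/-- A step with nonzero result exchanges entries that do not differ by one, which keeps a standard
tableau of the same shape. Entries beyond `L`, such as those of appended cells, are never moved. -/
theorem NormalForm.isPath (hs : IsCoxeter s L) (hp : IsWeight s (L + 1) p.1 p.2)
    {μ : YoungDiagram} {Q : ℕ} (hQ : L < Q) (hμ : IsPath μ Q p.2) {q : V × (ℕ → ℝ)}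
    (h : NormalForm s p L q) (h0 : q.1 ≠ 0) : IsPath μ Q q.2 := by
  refine (h.step_induction (C := fun q => IsWeight s (L + 1) q.1 q.2 ∧ (q.1 ≠ 0 → IsPath μ Q q.2))
    ⟨hp, fun _ => hμ⟩ fun i hi q hq => ⟨hq.1.step hs le_rfl (by omega), fun hne => ?_⟩).2 h0
  have h1 : q.1 ≠ 0 := by
    intro e
    apply hne
    rw [TabloidFFT.step, e, map_zero, smul_zero, sub_zero]
  have h2 := (hq.1.step_eq_zero_iff hs le_rfl h1 (i := i) (by omega)).not.1 hne
  push Not at h2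
  exact (hq.2 h1).swap (by omega) h2.1 h2.2

/-! ### Invariants of the subgroups in the chain -/

/-- Invariants carry the weight of the one-row tableau, which is how they are located among the
weight vectors. -/
theorem jm_of_mem_fixedVectors {r : ℕ} {v : V} (h : v ∈ fixedVectors s r) {t : ℕ} (ht : t < r) :
    jm s t v = (t : ℂ) • v := by
  induction t with
  | zero => simp [jm]
  | succ t ih =>
    rw [jm_succ_apply, h t ht, ih (by omega), map_smul, h t ht]
    push_cast
    module

open scoped InnerProductSpace

/-- Commuting symmetric operators are simultaneously diagonalizable, with real eigenvalues. -/
theorem IsCoxeter.exists_weight [FiniteDimensional ℂ V] [Nontrivial V] (hs : IsCoxeter s L) :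
    ∃ (v : V) (a : ℕ → ℝ), v ≠ 0 ∧ IsWeight s (L + 1) v a := by
  have htop := LinearMap.IsSymmetric.iSup_iInf_eq_top_of_commute
    (T := fun i : Fin (L + 1) => jm s i) (fun i => hs.jm_isSymmetric (by omega))
    fun i j _ => LinearMap.ext fun v => hs.jm_comm (by omega) (by omega) v
  obtain ⟨χ, hχ⟩ : ∃ χ : Fin (L + 1) → ℂ,
      ⨅ i : Fin (L + 1), Module.End.eigenspace (jm s i) (χ i) ≠ ⊥ := by
    by_contra hcon
    push Not at hcon
    simp only [hcon, iSup_bot] at htop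
    exact bot_ne_top htop
  obtain ⟨v, hv, hv0⟩ := Submodule.exists_mem_ne_zero_of_ne_bot hχ
  rw [Submodule.mem_iInf] at hv
  refine ⟨v, fun t => if h : t < L + 1 then (χ ⟨t, h⟩).re else 0, hv0, fun t ht => ?_⟩
  have h1 := hv ⟨t, ht⟩
  have h2 := (hs.jm_isSymmetric (i := t) (by omega)).conj_eigenvalue_eq_self
    (Module.End.hasEigenvalue_of_hasEigenvector ⟨h1, hv0⟩)
  simp only [dif_pos ht, Complex.conj_eq_iff_re.1 h2]
  exact Module.End.mem_eigenspace_iff.1 h1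

/-- In an irreducible module for the symmetric group, the dimensions of the spaces of
invariants of the subgroups in the chain are bounded by numbers of standard skew tableaux. -/
theorem IsCoxeter.finrank_fixedVectors_le [FiniteDimensional ℂ V] [Nontrivial V]
    (hs : IsCoxeter s L)
    (hirr : ∀ U : Submodule ℂ V, (∀ i < L, ∀ v ∈ U, s i v ∈ U) → U = ⊥ ∨ U = ⊤) (e : ℕ) :
    ∃ μ : YoungDiagram, μ.card = L + 1 + e ∧
      ∀ r ≤ L + 1, Module.finrank ℂ (fixedVectors s r) ≤ numSkew μ (oneRow r) := by
  classical
  obtain ⟨v, a₀, hv, hw₀⟩ := hs.exists_weight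
  obtain ⟨μ₀, hμ₀⟩ := hw₀.exists_isPath hs le_rfl hv
  obtain ⟨μ, a, hμ, haa⟩ := hμ₀.exists_extend e
  have hw : IsWeight s (L + 1) v a := hw₀.mono le_rfl fun t ht => (haa t ht).symm
  refine ⟨μ, hμ.card, fun r hr => ?_⟩
  set p : V × (ℕ → ℝ) := (v, a) with hp
  -- Solving the definition of `step` for `s i q.1` is possible because consecutive entries differ;
  -- so the span is stable under the generators.
  have hspan : Submodule.span ℂ (Prod.fst '' {q | NormalForm s p L q}) = ⊤ := by
    refine (hirr _ fun i hi x hx => ?_).resolve_left fun hbot => ?_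
    · induction hx using Submodule.span_induction with
      | mem x hx =>
        obtain ⟨q, hq, rfl⟩ := hx
        by_cases hq0 : q.1 = 0
        · rw [hq0, map_zero]
          exact Submodule.zero_mem _
        have hqw := hq.isWeight hs le_rfl hw
        have hne := hqw.ne_of_ne_zero hs le_rfl hq0 (i := i) (by omega)
        obtain ⟨c, q', hq', hst⟩ := hq.exists_step hs le_rfl hi
        have e1 : ((q.2 (i + 1) - q.2 i : ℝ) : ℂ) • s i q.1 = c • q'.1 + q.1 := by
          rw [← sub_eq_iff_eq_add]
          exact congrArg Prod.fst hst
        have hne' : ((q.2 (i + 1) - q.2 i : ℝ) : ℂ) ≠ 0 := by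
          rw [Complex.ofReal_ne_zero]
          exact sub_ne_zero.2 hne
        rw [← Submodule.smul_mem_iff _ hne', e1]
        exact Submodule.add_mem _
          (Submodule.smul_mem _ _ (Submodule.subset_span ⟨q', hq', rfl⟩))
          (Submodule.subset_span ⟨q, hq, rfl⟩)
      | zero => rw [map_zero]; exact Submodule.zero_mem _
      | add x y _ _ h1 h2 => rw [map_add]; exact Submodule.add_mem _ h1 h2
      | smul c x _ h1 => rw [map_smul]; exact Submodule.smul_mem _ _ h1
    · have : v ∈ Submodule.span ℂ (Prod.fst '' {q | NormalForm s p L q}) :=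
        Submodule.subset_span ⟨p, NormalForm.self s p L, rfl⟩
      rw [hbot, Submodule.mem_bot] at this
      exact hv this
  let G : Set (V × (ℕ → ℝ)) := {q | NormalForm s p L q ∧ q.1 ≠ 0 ∧ ∀ t < r, q.2 t = t}
  have hG : G.Finite := (NormalForm.finite s p L).subset fun q hq => hq.1
  have hGinj : Set.InjOn Prod.snd (hG.toFinset : Set (V × (ℕ → ℝ))) := by
    intro q hq q' hq' he
    simp only [Set.Finite.coe_toFinset] at hq hq'
    exact hq.1.eq_of_weight_eq hs hw le_rfl hq'.1 hq.2.1 hq'.2.1 he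
  have hcard : hG.toFinset.card ≤ numSkew μ (oneRow r) := by
    rw [← Finset.card_image_of_injOn hGinj]
    refine card_le_numSkew (q := L + 1 + e) (by omega) _ ?_ ?_
    · intro b hb
      obtain ⟨q, hq, rfl⟩ := Finset.mem_image.1 hb
      rw [Set.Finite.mem_toFinset] at hq
      exact ⟨hq.1.isPath hs hw (by omega) hμ hq.2.1, hq.2.2⟩
    · intro b hb b' hb' t ht
      obtain ⟨q, hq, rfl⟩ := Finset.mem_image.1 hb
      obtain ⟨q', hq', rfl⟩ := Finset.mem_image.1 hb'
      rw [Set.Finite.mem_toFinset] at hq hq'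
      rw [hq.1.weight_eq (by omega), hq'.1.weight_eq (by omega)]
  refine le_trans ?_ hcard
  -- Eigenvectors of symmetric operators for different eigenvalues are orthogonal, so an invariant
  -- vector can pair nontrivially only with members of `G`. If these pairings vanish too, it is
  -- orthogonal to everything.
  let Ψ : fixedVectors s r →ₗ[ℂ] (hG.toFinset → ℂ) :=
    LinearMap.pi fun q => (innerₛₗ ℂ q.1.1) ∘ₗ (fixedVectors s r).subtype
  have hΨ : Function.Injective Ψ := by
    rw [← LinearMap.ker_eq_bot, LinearMap.ker_eq_bot']
    rintro ⟨x, hx⟩ h0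
    have hperp : x ∈ (Submodule.span ℂ (Prod.fst '' {q | NormalForm s p L q}))ᗮ := by
      rw [Submodule.mem_orthogonal]
      intro y hy
      induction hy using Submodule.span_induction with
      | mem y hy =>
        obtain ⟨q, hq, rfl⟩ := hy
        by_cases hq0 : q.1 = 0
        · rw [hq0, inner_zero_left]
        by_cases hqr : ∀ t < r, q.2 t = t
        · exact congrFun h0 ⟨q, hG.mem_toFinset.2 ⟨hq, hq0, hqr⟩⟩
        · push Not at hqr
          obtain ⟨t, ht, hne⟩ := hqr
          have h1 := hs.jm_isSymmetric (i := t) (by omega) q.1 x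
          rw [hq.isWeight hs le_rfl hw t (by omega), jm_of_mem_fixedVectors hx ht, inner_smul_left,
            inner_smul_right, Complex.conj_ofReal, ← sub_eq_zero, ← sub_mul] at h1
          refine (mul_eq_zero.1 h1).resolve_left fun h2 => hne ?_
          rw [sub_eq_zero] at h2
          exact_mod_cast h2
      | zero => rw [inner_zero_left]
      | add y z _ _ h1 h2 => rw [inner_add_left, h1, h2, add_zero]
      | smul c y _ h1 => rw [inner_smul_left, h1, mul_zero]
    rw [hspan, Submodule.top_orthogonal_eq_bot, Submodule.mem_bot] at hperp
    exact Subtype.ext hperp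
  have := LinearMap.finrank_le_finrank_of_injective hΨ
  rwa [Module.finrank_fintype_fun_eq_card, Fintype.card_coe] at this

end NormalForms

/-! ### Irreducible representations of the symmetric groups in the chain -/

section Chain

variable {n : ℕ}

theorem mem_symSub {l : ℕ} {g : Equiv.Perm (Fin n)} :
    g ∈ symSub n l ↔ ∀ a : Fin n, l ≤ a → g a = a := by
  rw [mem_fixingSubgroup_iff]
  rfl

/-- Adjacent transpositions generate `S_l`. -/
theorem symSub_induction {P : Equiv.Perm (Fin n) → Prop} {l : ℕ} (hl : l ≤ n) (h1 : P 1)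
    (hmul : ∀ i (h : i + 1 < l) g, P g →
      P (Equiv.swap ⟨i, by omega⟩ ⟨i + 1, by omega⟩ * g)) (g : Equiv.Perm (Fin n))
    (hg : g ∈ symSub n l) : P g := by
  suffices hsuff : ∀ m ≤ l, ∀ g ∈ symSub n m, P g from hsuff l le_rfl g hg
  intro m
  induction m with
  | zero =>
    intro _ g hg
    have : g = 1 := Equiv.ext fun a => mem_symSub.1 hg a (Nat.zero_le _)
    rwa [this]
  | succ m ih =>
    intro hm
    -- Here `d` is the distance from the image of `m` back to `m`; each adjacent transposition
    -- reduces it by one, and at distance 0 the permutation lies in `S_m`.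
    have key : ∀ d (g : Equiv.Perm (Fin n)), g ∈ symSub n (m + 1) →
        (g ⟨m, by omega⟩ : ℕ) + d = m → P g := by
      intro d
      induction d with
      | zero =>
        intro g hg hd
        refine ih (by omega) g (mem_symSub.2 fun a ha => ?_)
        by_cases ham : (a : ℕ) = m
        · have : a = ⟨m, by omega⟩ := Fin.ext ham
          rw [this]
          exact Fin.ext hd
        · exact mem_symSub.1 hg a (by omega)
      | succ d ihd =>
        intro g hg hd
        set i : ℕ := (g ⟨m, by omega⟩ : ℕ) with hi
        set σ : Equiv.Perm (Fin n) := Equiv.swap ⟨i, by omega⟩ ⟨i + 1, by omega⟩ with hσ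
        have hgσ : g = σ * (σ * g) := by rw [← mul_assoc, hσ, Equiv.swap_mul_self, one_mul]
        rw [hgσ]
        refine hmul i (by omega) _ (ihd _ (mem_symSub.2 fun a ha => ?_) ?_)
        · rw [Equiv.Perm.mul_apply, mem_symSub.1 hg a ha, hσ, Equiv.swap_apply_of_ne_of_ne]
          · intro e; have := congrArg Fin.val e; simp only at this; omega
          · intro e; have := congrArg Fin.val e; simp only at this; omega
        · have : g ⟨m, by omega⟩ = ⟨i, by omega⟩ := Fin.ext hi.symm
          rw [Equiv.Perm.mul_apply, this, hσ, Equiv.swap_apply_left]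
          simp only
          omega
    intro g hg
    have hlt : (g ⟨m, by omega⟩ : ℕ) ≤ m := by
      by_contra hcon
      have h2 := mem_symSub.1 hg (g ⟨m, by omega⟩) (by omega)
      have := congrArg Fin.val (g.injective h2)
      simp only at this
      omega
    exact key (m - (g ⟨m, by omega⟩ : ℕ)) g hg (by omega)

/-- The adjacent transposition of `i` and `i + 1` (the identity if it is not in `S_l`). -/
def gen (n l : ℕ) (i : ℕ) : symSub n l :=
  if h : i + 1 < l ∧ l ≤ n then
    ⟨Equiv.swap ⟨i, by omega⟩ ⟨i + 1, by omega⟩, mem_symSub.2 fun a ha => by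
      refine Equiv.swap_apply_of_ne_of_ne ?_ ?_ <;>
      · intro e
        have := congrArg Fin.val e
        simp only at this
        omega⟩
  else 1

theorem gen_val {l i : ℕ} (h : i + 1 < l) (hl : l ≤ n) :
    (gen n l i).1 = Equiv.swap ⟨i, by omega⟩ ⟨i + 1, by omega⟩ := by
  rw [gen, dif_pos ⟨h, hl⟩]

theorem gen_mul_self (n l i : ℕ) : gen n l i * gen n l i = 1 := by
  unfold gen
  split_ifs
  · exact Subtype.ext (Equiv.swap_mul_self _ _)
  · rfl

theorem gen_comm {l i j : ℕ} (hij : i + 1 < j) (hj : j + 1 < l) (hl : l ≤ n) :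
    gen n l i * gen n l j = gen n l j * gen n l i := by
  refine Subtype.ext ?_
  rw [Subgroup.coe_mul, Subgroup.coe_mul, gen_val (by omega) hl, gen_val hj hl]
  ext a
  simp only [Equiv.Perm.mul_apply, Equiv.swap_apply_def]
  grind

theorem gen_braid {l i : ℕ} (hi : i + 2 < l) (hl : l ≤ n) :
    gen n l i * (gen n l (i + 1) * gen n l i) =
      gen n l (i + 1) * (gen n l i * gen n l (i + 1)) := by
  refine Subtype.ext ?_
  simp only [Subgroup.coe_mul]
  rw [gen_val (by omega) hl, gen_val (by omega) hl]
  ext a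
  simp only [Equiv.Perm.mul_apply, Equiv.swap_apply_def]
  grind

end Chain

/-- The average of an inner product over a finite group. -/
@[reducible]
noncomputable def invariantCore {G V : Type*} [Group G] [Fintype G] [AddCommGroup V] [Module ℂ V]
    [FiniteDimensional ℂ V] (τ : Representation ℂ G V) : InnerProductSpace.Core ℂ V where
  inner x y := ∑ g, ∑ i, starRingEnd ℂ ((Module.finBasis ℂ V).repr (τ g x) i) *
    (Module.finBasis ℂ V).repr (τ g y) i
  conj_inner_symm x y := by
    simp only [map_sum, map_mul, Complex.conj_conj]
    exact Finset.sum_congr rfl fun g _ => Finset.sum_congr rfl fun i _ => mul_comm _ _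
  re_inner_nonneg x := by
    simp only [map_sum]
    refine Finset.sum_nonneg fun g _ => Finset.sum_nonneg fun i _ => ?_
    rw [← Complex.normSq_eq_conj_mul_self]
    exact Complex.normSq_nonneg _
  add_left x y z := by
    simp only [map_add, Finsupp.add_apply, add_mul, Finset.sum_add_distrib]
  smul_left x y c := by
    simp only [map_smul, Finsupp.smul_apply, smul_eq_mul, map_mul, mul_assoc, Finset.mul_sum]
  definite x hx := by
    have hx' := congrArg Complex.re hx
    simp only [← Complex.normSq_eq_conj_mul_self, ← Complex.ofReal_sum, Complex.ofReal_re,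
      Complex.zero_re] at hx'
    rw [Finset.sum_eq_zero_iff_of_nonneg
      fun g _ => Finset.sum_nonneg fun i _ => Complex.normSq_nonneg _] at hx'
    have h1 := hx' 1 (Finset.mem_univ _)
    rw [Finset.sum_eq_zero_iff_of_nonneg fun i _ => Complex.normSq_nonneg _] at h1
    rw [map_one] at h1
    rw [← (Module.finBasis ℂ V).repr.map_eq_zero_iff]
    ext i
    exact Complex.normSq_eq_zero.1 (h1 i (Finset.mem_univ _))

theorem invariantCore_inner {G V : Type*} [Group G] [Fintype G] [AddCommGroup V] [Module ℂ V]
    [FiniteDimensional ℂ V] (τ : Representation ℂ G V) (h : G) (x y : V) :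
    (invariantCore τ).inner (τ h x) (τ h y) = (invariantCore τ).inner x y := by
  refine Fintype.sum_equiv (Equiv.mulRight h) _ _ fun g => ?_
  rw [Equiv.coe_mulRight, map_mul]
  rfl

/-- The dimensions of the invariants of `S_r` in an irreducible representation of `S_l` are
bounded by the numbers of standard skew tableaux of a suitable shape. -/
theorem finrank_fixedVectors_le {n l : ℕ} (hl0 : 1 ≤ l) (hl : l ≤ n) {V : Type*} [AddCommGroup V]
    [Module ℂ V] [FiniteDimensional ℂ V] (τ : Representation ℂ (symSub n l) V)
    (hτ : τ.IsIrreducible) (e : ℕ) :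
    ∃ μ : YoungDiagram, μ.card = l + e ∧ ∀ r ≤ l,
      Module.finrank ℂ (fixedVectors (fun i => τ (gen n l i)) r) ≤ numSkew μ (oneRow r) := by
  classical
  have : Fintype (symSub n l) := Fintype.ofFinite _
  let c := invariantCore τ
  let : NormedAddCommGroup V := c.toNormedAddCommGroup
  let : InnerProductSpace ℂ V := InnerProductSpace.ofCore c.toCore
  obtain ⟨L, rfl⟩ : ∃ L, l = L + 1 := ⟨l - 1, by omega⟩
  have hmul : ∀ g h : symSub n (L + 1), ∀ v, τ g (τ h v) = τ (g * h) v := fun g h v => by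
    rw [map_mul]
    rfl
  have hs : IsCoxeter (fun i => τ (gen n (L + 1) i)) L := by
    refine ⟨fun i hi x y => ?_, fun i hi v => ?_, fun i j hij hj v => ?_, fun i hi v => ?_⟩
    · have h1 := invariantCore_inner τ (gen n (L + 1) i) x (τ (gen n (L + 1) i) y)
      rw [hmul, gen_mul_self, map_one] at h1
      exact h1
    · rw [hmul, gen_mul_self, map_one]
      rfl
    · rw [hmul, hmul, gen_comm hij (by omega) hl]
    · rw [hmul, hmul, hmul, hmul, mul_assoc, mul_assoc, gen_braid (by omega) hl]
  have hnt : Nontrivial V := by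
    by_contra hcon
    rw [not_nontrivial_iff_subsingleton] at hcon
    exact hτ.toNontrivial.exists_pair_ne.elim fun a ⟨b, hab⟩ => hab (by
      ext x
      rw [Subsingleton.elim x 0]
      exact ⟨fun _ => b.toSubmodule.zero_mem, fun _ => a.toSubmodule.zero_mem⟩)
  refine hs.finrank_fixedVectors_le (fun U hU => ?_) e
  have hstable : ∀ g ∈ symSub n (L + 1), ∀ h : g ∈ symSub n (L + 1), ∀ v ∈ U, τ ⟨g, h⟩ v ∈ U := by
    intro g hg
    refine symSub_induction (P := fun g => ∀ h : g ∈ symSub n (L + 1), ∀ v ∈ U, τ ⟨g, h⟩ v ∈ U) hl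
      (fun h v hv => ?_) (fun i hi g ih h v hv => ?_) g hg
    · have : (⟨1, h⟩ : symSub n (L + 1)) = 1 := rfl
      rw [this, map_one]
      exact hv
    · have hg' : g ∈ symSub n (L + 1) := by
        have h1 := (gen n (L + 1) i).2
        rw [gen_val hi hl] at h1
        exact (Subgroup.mul_mem_cancel_left _ h1).1 h
      have : (⟨_, h⟩ : symSub n (L + 1)) = gen n (L + 1) i * ⟨g, hg'⟩ :=
        Subtype.ext (by rw [Subgroup.coe_mul, gen_val hi hl])
      rw [this, ← hmul]
      exact hU i (by omega) _ (ih hg' v hv)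
  let W : Subrepresentation τ := ⟨U, fun g v hv => hstable g.1 g.2 g.2 v hv⟩
  rcases hτ.eq_bot_or_eq_top W with h | h
  · exact Or.inl (congrArg Subrepresentation.toSubmodule h)
  · exact Or.inr (congrArg Subrepresentation.toSubmodule h)

/-! ### Straight-line computation of sparse matrix products -/

theorem Computes.zero_mem {ι : Type} {t : ℕ} {S : Set ((ι → ℂ) → ℂ)} (h : Computes t S) :
    (fun _ => 0) ∈ S := by
  induction h with
  | init => exact Or.inl rfl
  | add _ _ _ ih => exact Or.inr ih
  | sub _ _ _ ih => exact Or.inr ih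
  | smul _ _ _ ih => exact Or.inr ih

/-- A linear combination of `e` available quantities costs at most `2 e - 1` operations. -/
theorem Computes.exists_sum {ι κ : Type} {t : ℕ} {S : Set ((ι → ℂ) → ℂ)} (h : Computes t S)
    (a : κ → ℂ) (u : κ → (ι → ℂ) → ℂ) (s : Finset κ) (hu : ∀ i ∈ s, u i ∈ S) :
    ∃ t' S', Computes t' S' ∧ S ⊆ S' ∧ t' ≤ t + (2 * s.card - 1) ∧
      (fun x => ∑ i ∈ s, a i * u i x) ∈ S' := by
  classical
  induction s using Finset.induction_on with
  | empty => exact ⟨t, S, h, subset_rfl, by omega, by simpa using h.zero_mem⟩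
  | insert i s hi ih =>
    obtain ⟨t', S', h', hS, ht, hm⟩ := ih fun i hi => hu i (Finset.mem_insert_of_mem hi)
    have h2 := h'.smul (a i) (hS (hu i (Finset.mem_insert_self i s)))
    rw [Finset.card_insert_of_notMem hi]
    -- The first summand needs no addition, whence the `- 1`.
    rcases s.eq_empty_or_nonempty with rfl | hne
    · refine ⟨_, _, h2, fun u hu => Or.inr (hS hu), by simp at ht ⊢; omega, Or.inl ?_⟩
      simp
    · have := hne.card_pos
      refine ⟨_, _, h2.add (Or.inl rfl) (Or.inr hm), fun u hu => Or.inr (Or.inr (hS hu)),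
        by omega, Or.inl ?_⟩
      funext x
      rw [Finset.sum_insert hi]

/-- The product of a matrix with at most `e` nonzero entries in each row and a vector of
available quantities. -/
theorem Computes.exists_mulVec {ι κ κ' : Type} [Fintype κ] [Fintype κ'] {t : ℕ}
    {S : Set ((ι → ℂ) → ℂ)} (h : Computes t S) (A : Matrix κ' κ ℂ) (u : κ → (ι → ℂ) → ℂ)
    (hu : ∀ i, u i ∈ S) {e : ℕ}
    (he : ∀ i, ∀ s : Finset κ, (∀ j ∈ s, A i j ≠ 0) → s.card ≤ e) :
    ∃ t' S', Computes t' S' ∧ t' ≤ t + Fintype.card κ' * (2 * e - 1) ∧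
      ∀ i, (fun x => A.mulVec (fun j => u j x) i) ∈ S' := by
  classical
  suffices hsuff : ∀ s : Finset κ', ∃ t' S', Computes t' S' ∧ S ⊆ S' ∧
      t' ≤ t + s.card * (2 * e - 1) ∧ ∀ i ∈ s, (fun x => A.mulVec (fun j => u j x) i) ∈ S' by
    obtain ⟨t', S', h1, -, h2, h3⟩ := hsuff Finset.univ
    exact ⟨t', S', h1, h2, fun i => h3 i (Finset.mem_univ i)⟩
  intro s
  induction s using Finset.induction_on with
  | empty => exact ⟨t, S, h, subset_rfl, by simp, by simp⟩
  | insert i s hi ih =>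
    obtain ⟨t', S', h', hS, ht, hm⟩ := ih
    obtain ⟨t'', S'', h'', hS', ht', hm'⟩ := h'.exists_sum (A i) u
      (Finset.univ.filter fun j => A i j ≠ 0) fun j _ => hS (hu j)
    have hcard := he i (Finset.univ.filter fun j => A i j ≠ 0)
      fun j hj => (Finset.mem_filter.1 hj).2
    refine ⟨t'', S'', h'', hS.trans hS', ?_, fun j hj => ?_⟩
    · rw [Finset.card_insert_of_notMem hi, add_mul, one_mul]
      omega
    · rcases Finset.mem_insert.1 hj with rfl | hj
      · convert hm' using 1
        funext x
        rw [Matrix.mulVec, dotProduct, Finset.sum_filter_of_ne]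
        exact fun j _ hj h0 => hj (by rw [h0, zero_mul])
      · exact hS' (hm j hj)

theorem omega_le {ι : Type} [Fintype ι] {A : Matrix ι ι ℂ} {t : ℕ} {S : Set ((ι → ℂ) → ℂ)}
    (h : Computes t S) (hA : ∀ i, (fun x : ι → ℂ => A.mulVec x i) ∈ S) : omega A ≤ t :=
  Nat.sInf_le ⟨S, h, hA⟩

theorem computes_init_mem {ι : Type} (i : ι) : (fun x : ι → ℂ => x i) ∈
    (insert (fun _ => 0) (Set.range fun (i : ι) (x : ι → ℂ) => x i) : Set ((ι → ℂ) → ℂ)) :=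
  Or.inr ⟨i, rfl⟩

theorem omega_le_naive {ι : Type} [Fintype ι] (A : Matrix ι ι ℂ) :
    omega A ≤ Fintype.card ι * (2 * Fintype.card ι - 1) := by
  obtain ⟨t, S, h, ht, hm⟩ := (Computes.init (ι := ι)).exists_mulVec A (fun i x => x i)
    computes_init_mem (e := Fintype.card ι) fun i s _ => s.card_le_univ
  exact (omega_le h hm).trans (by omega)

/-- The cost of a change of basis that factors into sparse ones. -/
theorem omega_toMatrix_le {ι V : Type} [Fintype ι] [AddCommGroup V] [Module ℂ V]
    (B : ℕ → Module.Basis ι ℂ V) (e d : ℕ)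
    (he : ∀ j < d, ∀ i, ∀ s : Finset ι,
      (∀ i' ∈ s, (B (j + 2)).toMatrix (B (j + 1)) i i' ≠ 0) → s.card ≤ e) :
    omega ((B (d + 1)).toMatrix (B 1)) ≤ d * (Fintype.card ι * (2 * e - 1)) := by
  classical
  suffices hsuff : ∃ t S, Computes t S ∧ t ≤ d * (Fintype.card ι * (2 * e - 1)) ∧
      ∀ i, (fun x : ι → ℂ => ((B (d + 1)).toMatrix (B 1)).mulVec x i) ∈ S by
    obtain ⟨t, S, h, ht, hm⟩ := hsuff
    exact (omega_le h hm).trans ht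
  induction d with
  | zero =>
    refine ⟨0, _, Computes.init, by simp, fun i => ?_⟩
    simp only [zero_add, Module.Basis.toMatrix_self, Matrix.one_mulVec]
    exact computes_init_mem i
  | succ d ih =>
    obtain ⟨t, S, h, ht, hm⟩ := ih fun j hj => he j (by omega)
    obtain ⟨t', S', h', ht', hm'⟩ := h.exists_mulVec ((B (d + 2)).toMatrix (B (d + 1)))
      (fun i x => ((B (d + 1)).toMatrix (B 1)).mulVec x i) hm (he d (by omega))
    refine ⟨t', S', h', by rw [add_mul, one_mul]; omega, fun i => ?_⟩
    convert hm' i using 2 with x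
    change _ = (Matrix.mulVec _ (Matrix.mulVec _ x)) i
    rw [Matrix.mulVec_mulVec, Module.Basis.toMatrix_mul_toMatrix]

/-! ### Tabloids of hook shape -/

section Tabloid

variable {n k : ℕ}

instance {r : ℕ} (n : ℕ) (α : Fin r → ℕ) : Fintype (Tabloid n α) :=
  inferInstanceAs (Fintype {_T : Fin n → Fin r // _})

theorem Tabloid.existsUnique_succ (T : Tabloid n (hook n k)) (i : Fin k) :
    ∃! a, T.1 a = i.succ := by
  have h : (Finset.univ.filter fun a => T.1 a = i.succ).card = 1 := T.2 i.succ
  rw [Finset.card_eq_one] at h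
  obtain ⟨a, ha⟩ := h
  have hm : ∀ b, T.1 b = i.succ ↔ b = a := fun b => by
    simpa using Finset.ext_iff.1 ha b
  exact ⟨a, (hm a).2 rfl, fun b hb => (hm b).1 hb⟩

open Classical in
/-- The tabloid of hook shape whose single-cell rows contain the values of an embedding. -/
noncomputable def tabloidOfEmbedding (n k : ℕ) (f : Fin k ↪ Fin n) : Tabloid n (hook n k) :=
  ⟨fun a => if h : ∃ i, f i = a then (h.choose).succ else 0, by
    have hf : ∀ (i : Fin k) (a : Fin n),
        (if h : ∃ i, f i = a then (h.choose).succ else 0) = i.succ ↔ a = f i := by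
      intro i a
      split_ifs with h
      · rw [Fin.succ_inj]
        refine ⟨fun e => by rw [← e, h.choose_spec], fun e => f.injective ?_⟩
        rw [h.choose_spec, e]
      · exact ⟨fun e => absurd e.symm (Fin.succ_ne_zero i), fun e => absurd ⟨i, e.symm⟩ h⟩
    have hf0 : ∀ a : Fin n, (if h : ∃ i, f i = a then (h.choose).succ else 0) = 0 ↔
        a ∈ (Finset.univ.map f)ᶜ := by
      intro a
      rw [Finset.mem_compl, Finset.mem_map]
      split_ifs with h
      · obtain ⟨i, hi⟩ := h
        exact ⟨fun e => absurd e (Fin.succ_ne_zero _),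
          fun e => absurd ⟨i, Finset.mem_univ i, hi⟩ e⟩
      · exact ⟨fun _ ⟨i, _, hi⟩ => h ⟨i, hi⟩, fun _ => rfl⟩
    refine Fin.cases ?_ fun i => ?_
    · simp only [hf0, Finset.filter_mem_eq_inter, Finset.univ_inter]
      rw [Finset.card_compl, Finset.card_map, Finset.card_univ, Fintype.card_fin, Fintype.card_fin]
      rfl
    · simp only [hf]
      rw [Finset.filter_eq' Finset.univ (f i), if_pos (Finset.mem_univ _), Finset.card_singleton]
      rfl⟩

theorem tabloidOfEmbedding_apply (f : Fin k ↪ Fin n) (i : Fin k) :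
    (tabloidOfEmbedding n k f).1 (f i) = i.succ := by
  have h : ∃ i', f i' = f i := ⟨i, rfl⟩
  simp only [tabloidOfEmbedding]
  rw [dif_pos h, f.injective h.choose_spec]

theorem tabloidOfEmbedding_eq_zero (f : Fin k ↪ Fin n) {a : Fin n} (h : ¬ ∃ i, f i = a) :
    (tabloidOfEmbedding n k f).1 a = 0 := by
  simp only [tabloidOfEmbedding]
  rw [dif_neg h]

/-- A tabloid of this shape amounts to the injective list of the entries of its single-cell rows. -/
theorem card_tabloid_hook (n k : ℕ) :
    Fintype.card (Tabloid n (hook n k)) = n.descFactorial k := by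
  have hbij : Function.Bijective (tabloidOfEmbedding n k) := by
    refine ⟨fun f f' he => ?_, fun T => ?_⟩
    · ext i : 1
      refine ((tabloidOfEmbedding n k f).existsUnique_succ i).unique
        (tabloidOfEmbedding_apply f i) ?_
      rw [he]
      exact tabloidOfEmbedding_apply f' i
    · choose g hg hg' using fun i => T.existsUnique_succ i
      let f : Fin k ↪ Fin n := ⟨g, fun i i' he => by
        have := (hg i).symm.trans ((congrArg T.1 he).trans (hg i'))
        exact Fin.succ_injective _ this⟩
      refine ⟨f, Subtype.ext (funext fun a => ?_)⟩
      by_cases h : ∃ i, f i = a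
      · obtain ⟨i, rfl⟩ := h
        rw [tabloidOfEmbedding_apply]
        exact (hg i).symm
      · rw [tabloidOfEmbedding_eq_zero f h]
        by_contra hcon
        obtain ⟨i, hi⟩ := Fin.exists_succ_eq_of_ne_zero (Ne.symm hcon)
        exact h ⟨i, (hg' i a hi.symm).symm⟩
  rw [← Fintype.card_of_bijective hbij, Fintype.card_embedding_eq, Fintype.card_fin,
    Fintype.card_fin]

end Tabloid

/-! ### Orbits of tabloids -/

section Orbits

variable {n k : ℕ}

theorem symSub_mono {l j : ℕ} (h : l ≤ j) : symSub n l ≤ symSub n j := fun _ hg =>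
  mem_symSub.2 fun a ha => mem_symSub.1 hg a (h.trans ha)

theorem symSub_apply_lt_iff {l : ℕ} {g : Equiv.Perm (Fin n)} (hg : g ∈ symSub n l) (a : Fin n) :
    (g a : ℕ) < l ↔ (a : ℕ) < l := by
  constructor
  · intro h
    by_contra hcon
    rw [mem_symSub.1 hg a (by omega)] at h
    exact hcon h
  · intro h
    by_contra hcon
    have := g.injective (mem_symSub.1 hg (g a) (by omega))
    rw [this] at hcon
    exact hcon h

/-- Two labellings of the points that agree from `l` on and use every label equally often on the
first `l` points are conjugate under `S_l`. -/
theorem exists_symSub_of_card_eq {β : Type} [DecidableEq β] {l : ℕ} (f f' : Fin n → β)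
    (htail : ∀ a : Fin n, l ≤ a → f a = f' a)
    (hcard : ∀ c, (Finset.univ.filter fun a : Fin n => (a : ℕ) < l ∧ f a = c).card =
      (Finset.univ.filter fun a : Fin n => (a : ℕ) < l ∧ f' a = c).card) :
    ∃ g ∈ symSub n l, ∀ a, f' (g a) = f a := by
  let P := {a : Fin n // (a : ℕ) < l}
  have hcnt : ∀ (h : Fin n → β) (c : β), Fintype.card {a : P // h a.1 = c} =
      (Finset.univ.filter fun a : Fin n => (a : ℕ) < l ∧ h a = c).card := by
    intro h c
    rw [← Fintype.card_subtype]
    exact Fintype.card_congr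
      (Equiv.subtypeSubtypeEquivSubtypeInter (fun a : Fin n => (a : ℕ) < l) fun a => h a = c)
  let E : ∀ c, {a : P // f a.1 = c} ≃ {a : P // f' a.1 = c} := fun c =>
    Fintype.equivOfCardEq (by rw [hcnt, hcnt, hcard])
  let e : Equiv.Perm P := (Equiv.sigmaFiberEquiv fun a : P => f a.1).symm.trans
    ((Equiv.sigmaCongrRight E).trans (Equiv.sigmaFiberEquiv fun a : P => f' a.1))
  have he : ∀ a : P, f' (e a).1 = f a.1 := fun a => (E (f a.1) ⟨a, rfl⟩).2
  refine ⟨Equiv.Perm.ofSubtype e, mem_symSub.2 fun a ha =>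
    Equiv.Perm.ofSubtype_apply_of_not_mem e (by omega), fun a => ?_⟩
  by_cases ha : (a : ℕ) < l
  · rw [Equiv.Perm.ofSubtype_apply_of_mem e ha, he]
  · rw [Equiv.Perm.ofSubtype_apply_of_not_mem e ha, htail a (by omega)]

/-- The number of points below `l` in the first row. -/
def zeros (l : ℕ) (T : Tabloid n (hook n k)) : ℕ :=
  (Finset.univ.filter fun a : Fin n => (a : ℕ) < l ∧ T.1 a = 0).card

theorem card_filter_lt {l : ℕ} (hl : l ≤ n) :
    (Finset.univ.filter fun a : Fin n => (a : ℕ) < l).card = l := by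
  rw [Fin.card_filter_val_lt, min_eq_right hl]

theorem zeros_le {l : ℕ} (hl : l ≤ n) (T : Tabloid n (hook n k)) : zeros l T ≤ l := by
  refine le_trans (Finset.card_le_card fun a ha => ?_) (card_filter_lt hl).le
  rw [Finset.mem_filter] at ha ⊢
  exact ⟨ha.1, ha.2.1⟩

theorem zeros_smul {l : ℕ} {g : Equiv.Perm (Fin n)} (hg : g ∈ symSub n l)
    (T : Tabloid n (hook n k)) : zeros l (g • T) = zeros l T := by
  refine Finset.card_equiv g⁻¹ fun a => ?_
  rw [Finset.mem_filter, Finset.mem_filter, symSub_apply_lt_iff (inv_mem hg)]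
  simp only [Finset.mem_univ, true_and]
  rfl

theorem zeros_succ {l : ℕ} (hl : l < n) (T : Tabloid n (hook n k)) :
    zeros (l + 1) T = zeros l T + if T.1 ⟨l, hl⟩ = 0 then 1 else 0 := by
  unfold zeros
  split_ifs with h
  · rw [← Finset.card_insert_of_notMem (a := (⟨l, hl⟩ : Fin n)) (by simp)]
    congr 1
    ext a
    simp only [Finset.mem_filter, Finset.mem_univ, true_and, Finset.mem_insert]
    constructor
    · rintro ⟨h1, h2⟩
      by_cases h3 : (a : ℕ) = l
      · exact Or.inl (Fin.ext h3)
      · exact Or.inr ⟨by omega, h2⟩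
    · rintro (rfl | ⟨h1, h2⟩)
      · exact ⟨Nat.lt_succ_self l, h⟩
      · exact ⟨by omega, h2⟩
  · rw [add_zero]
    congr 1
    ext a
    simp only [Finset.mem_filter, Finset.mem_univ, true_and]
    refine ⟨fun ⟨h1, h2⟩ => ⟨lt_of_le_of_ne (by omega) fun h3 => h ?_, h2⟩,
      fun ⟨h1, h2⟩ => ⟨by omega, h2⟩⟩
    rwa [← show a = ⟨l, hl⟩ from Fin.ext h3]

/-- Every tabloid is conjugate to one whose points of the first row come first. -/
theorem exists_smul_sorted {l : ℕ} (hl : l ≤ n) (T : Tabloid n (hook n k)) :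
    ∃ g ∈ symSub n l, ∀ a : Fin n, (a : ℕ) < zeros l T → (g • T).1 a = 0 := by
  have hz := zeros_le hl T
  have htrue : (Finset.univ.filter fun a : Fin n => (a : ℕ) < l ∧ (T.1 a = 0)).card =
      (Finset.univ.filter fun a : Fin n => (a : ℕ) < l ∧ (a : ℕ) < zeros l T).card := by
    refine (card_filter_lt (hz.trans hl)).symm.trans (congrArg Finset.card ?_)
    ext a
    simp only [Finset.mem_filter, Finset.mem_univ, true_and]
    omega
  have hsplit : ∀ p : Fin n → Prop, ∀ [DecidablePred p],
      (Finset.univ.filter fun a : Fin n => (a : ℕ) < l ∧ p a).card +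
        (Finset.univ.filter fun a : Fin n => (a : ℕ) < l ∧ ¬ p a).card = l := by
    intro p _
    rw [← Finset.filter_filter, ← Finset.filter_filter, Finset.card_filter_add_card_filter_not,
      card_filter_lt hl]
  have h1 := hsplit fun a => T.1 a = 0
  have h2 := hsplit fun a => (a : ℕ) < zeros l T
  -- Only membership in the first row matters, so two Boolean labellings are compared; both are
  -- `true` from `l` on to make the tails agree.
  obtain ⟨g, hg, hgf⟩ := exists_symSub_of_card_eq (l := l)
    (fun a => if (a : ℕ) < l then decide (T.1 a = 0) else true)
    (fun a => if (a : ℕ) < l then decide ((a : ℕ) < zeros l T) else true)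
    (fun a ha => by rw [if_neg (by omega), if_neg (by omega)]) (by
      have hc : ∀ (p : Fin n → Prop) [DecidablePred p] (c : Bool),
          (Finset.univ.filter fun a : Fin n => (a : ℕ) < l ∧
            (if (a : ℕ) < l then decide (p a) else true) = c).card =
          (Finset.univ.filter fun a : Fin n => (a : ℕ) < l ∧ (p a ↔ c = true)).card := by
        intro p _ c
        congr 1
        ext a
        simp only [Finset.mem_filter, Finset.mem_univ, true_and]
        refine and_congr_right fun ha => ?_
        rw [if_pos ha]
        cases c <;> simp
      intro c
      rw [hc, hc]
      cases c
      · simp only [Bool.false_eq_true, iff_false]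
        omega
      · simp only [iff_true]
        exact htrue)
  refine ⟨g, hg, fun a ha => ?_⟩
  have h3 := hgf (g⁻¹ a)
  have h4 : ((g⁻¹ a : Fin n) : ℕ) < l := (symSub_apply_lt_iff (inv_mem hg) a).2 (by omega)
  rw [show g (g⁻¹ a) = a from g.apply_symm_apply a, if_pos (by omega), if_pos h4,
    decide_eq_true ha] at h3
  exact of_decide_eq_true h3.symm

/-- Tabloids that agree from `l` on are conjugate under `S_l`. -/
theorem exists_smul_eq {l : ℕ} (T T' : Tabloid n (hook n k))
    (h : ∀ a : Fin n, l ≤ a → T.1 a = T'.1 a) : ∃ g ∈ symSub n l, g • T = T' := by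
  obtain ⟨g, hg, hgf⟩ := exists_symSub_of_card_eq (l := l) T.1 T'.1 h (by
    intro c
    -- The shape fixes the size of each row, so equal tails leave equal counts below `l`.
    have hsplit : ∀ U : Tabloid n (hook n k),
        (Finset.univ.filter fun a : Fin n => (a : ℕ) < l ∧ U.1 a = c).card +
          (Finset.univ.filter fun a : Fin n => ¬ (a : ℕ) < l ∧ U.1 a = c).card = hook n k c := by
      intro U
      rw [← U.2 c, ← Finset.card_filter_add_card_filter_not
        (s := Finset.univ.filter fun a : Fin n => U.1 a = c) (fun a : Fin n => (a : ℕ) < l),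
        Finset.filter_filter, Finset.filter_filter]
      congr 2 <;>
      · ext a
        simp only [Finset.mem_filter, Finset.mem_univ, true_and]
        exact and_comm
    have h1 := hsplit T
    have h2 := hsplit T'
    have h3 : (Finset.univ.filter fun a : Fin n => ¬ (a : ℕ) < l ∧ T.1 a = c) =
        Finset.univ.filter fun a : Fin n => ¬ (a : ℕ) < l ∧ T'.1 a = c := by
      ext a
      simp only [Finset.mem_filter, Finset.mem_univ, true_and]
      exact and_congr_right fun ha => by rw [h a (by omega)]
    rw [h3] at h1
    omega)
  refine ⟨g, hg, Subtype.ext (funext fun a => ?_)⟩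
  have := hgf (g⁻¹ a)
  rw [show g (g⁻¹ a) = a from g.apply_symm_apply a] at this
  exact this.symm

theorem smul_tail {l : ℕ} {g : Equiv.Perm (Fin n)} (hg : g ∈ symSub n l)
    (T : Tabloid n (hook n k)) {a : Fin n} (ha : l ≤ a) : (g • T).1 a = T.1 a :=
  congrArg T.1 (mem_symSub.1 (inv_mem hg) a ha)

theorem smul_eq_self_of_forall {l i : ℕ} (T : Tabloid n (hook n k)) {r : ℕ} (hr : r ≤ l)
    (hl : l ≤ n) (hT : ∀ a : Fin n, (a : ℕ) < r → T.1 a = 0) (hi : i + 1 < r) :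
    gen n l i • T = T := by
  refine Subtype.ext (funext fun a => ?_)
  change T.1 ((gen n l i).1⁻¹ a) = T.1 a
  rw [gen_val (by omega) hl, Equiv.swap_inv, Equiv.swap_apply_def]
  split_ifs with h1 h2
  · rw [h1, hT ⟨i + 1, by omega⟩ hi, hT ⟨i, by omega⟩ (Nat.lt_of_succ_lt hi)]
  · rw [h2, hT ⟨i + 1, by omega⟩ hi, hT ⟨i, by omega⟩ (Nat.lt_of_succ_lt hi)]
  · rfl

/-- The number of points below `l` outside of the first row is at most `k`. -/
theorem sub_zeros_le {l : ℕ} (hl : l ≤ n) (T : Tabloid n (hook n k)) : l - zeros l T ≤ k := by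
  have hsplit : zeros l T +
      (Finset.univ.filter fun a : Fin n => (a : ℕ) < l ∧ ¬ T.1 a = 0).card = l := by
    rw [zeros, ← Finset.filter_filter, ← Finset.filter_filter,
      Finset.card_filter_add_card_filter_not, card_filter_lt hl]
  have h2 : (Finset.univ.filter fun a : Fin n => (a : ℕ) < l ∧ ¬ T.1 a = 0).card ≤
      (Finset.univ.erase (0 : Fin (k + 1))).card := by
    refine Finset.card_le_card_of_injOn T.1 (fun a ha => ?_) fun a ha a' ha' he => ?_
    · simp only [Finset.coe_filter, Finset.mem_univ, true_and, Set.mem_ofPred_eq] at ha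
      simp [ha.2]
    · simp only [Finset.coe_filter, Finset.mem_univ, true_and, Set.mem_ofPred_eq] at ha ha'
      obtain ⟨i, hi⟩ := Fin.exists_succ_eq_of_ne_zero ha.2
      exact (T.existsUnique_succ i).unique hi.symm (he.symm.trans hi.symm)
  rw [Finset.card_erase_of_mem (Finset.mem_univ _), Finset.card_univ, Fintype.card_fin] at h2
  omega

/-- The single-cell rows whose entry is below `l`. -/
def lowRows (l : ℕ) (T : Tabloid n (hook n k)) : Finset (Fin k) :=
  Finset.univ.filter fun i => ∀ a : Fin n, l ≤ a → T.1 a ≠ i.succ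

theorem card_lowRows_le {l : ℕ} (hl : l ≤ n) (T : Tabloid n (hook n k)) :
    (lowRows l T).card ≤ l - zeros l T := by
  have hsplit : zeros l T +
      (Finset.univ.filter fun a : Fin n => (a : ℕ) < l ∧ ¬ T.1 a = 0).card = l := by
    rw [zeros, ← Finset.filter_filter, ← Finset.filter_filter,
      Finset.card_filter_add_card_filter_not, card_filter_lt hl]
  choose f hf _ using T.existsUnique_succ
  have : (lowRows l T).card ≤
      (Finset.univ.filter fun a : Fin n => (a : ℕ) < l ∧ ¬ T.1 a = 0).card := by
    refine Finset.card_le_card_of_injOn f (fun i hi => ?_) fun i _ i' _ he => ?_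
    · simp only [lowRows, Finset.coe_filter, Finset.mem_univ, true_and, Set.mem_ofPred_eq] at hi ⊢
      refine ⟨?_, ?_⟩
      · by_contra hcon
        exact hi (f i) (by omega) (hf i)
      · rw [show T.1 (f i) = i.succ from hf i]
        exact Fin.succ_ne_zero i
    · have h1 : i.succ = i'.succ := (hf i).symm.trans ((congrArg T.1 he).trans (hf i'))
      exact Fin.succ_injective _ h1
  omega

end Orbits

/-! ### Multiplicities -/

theorem le_rowLen_of_numSkew_ne_zero {μ : YoungDiagram} {r : ℕ} (h : numSkew μ (oneRow r) ≠ 0) :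
    r ≤ μ.rowLen 0 := by
  have hle : oneRow r ≤ μ := by
    by_contra hcon
    exact h (if_neg hcon)
  rcases r with _ | r
  · exact Nat.zero_le _
  · exact YoungDiagram.mem_iff_lt_rowLen.1 (hle (mem_oneRow.2 ⟨rfl, Nat.lt_succ_self r⟩))

/-- This is a term of `M (z + k + 1) k`. The condition on the first part costs nothing: if the first
row is shorter than `z`, both counts vanish. -/
theorem numSkew_add_le_N {μ : YoungDiagram} {z k : ℕ} (h : μ.card = z + k) :
    numSkew μ (oneRow z) + k * numSkew μ (oneRow (z + 1)) ≤ N k := by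
  by_cases hz : z ≤ μ.rowLen 0
  · have h1 : M (z + k + 1) k ≤ N k :=
      (isGreatest_N k).2 ⟨z + k + 1, Set.mem_ofPred_eq ▸ (by omega : k < z + k + 1), rfl⟩
    refine le_trans ?_ h1
    refine (isGreatest_M (n := z + k + 1) (k := k) (by omega)).1.2 ⟨μ, ⟨by omega, ?_⟩, ?_⟩
    · rw [show z + k + 1 - k - 1 = z by omega]
      exact hz
    · simp only
      rw [show z + k + 1 - k - 1 = z by omega, show z + k + 1 - k = z + 1 by omega]
  · have h1 : numSkew μ (oneRow z) = 0 := by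
      by_contra hcon
      exact hz (le_rowLen_of_numSkew_ne_zero hcon)
    have h2 : numSkew μ (oneRow (z + 1)) = 0 := by
      by_contra hcon
      exact hz ((Nat.le_succ z).trans (le_rowLen_of_numSkew_ne_zero hcon))
    rw [h1, h2]
    exact Nat.zero_le _

theorem permRep_single {G X : Type} [Group G] [MulAction G X] [DecidableEq X] (g : G) (x : X) :
    permRep G X g (Pi.single x 1) = Pi.single (g • x) 1 := by
  funext y
  change (Pi.single x 1 : X → ℂ) (g⁻¹ • y) = _
  by_cases h : y = g • x
  · rw [h, inv_smul_smul, Pi.single_eq_same, Pi.single_eq_same]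
  · rw [Pi.single_eq_of_ne h, Pi.single_eq_of_ne]
    exact fun e => h (by rw [← e, smul_inv_smul])

/-- The multiplicity of an irreducible representation of `S_l` in the functions on an
orbit of `S_{l+1}` on the tabloids of hook shape, expressed through linearly independent
equivariant maps, is at most `N k`. -/
theorem card_intertwiners_le_N {n k l : ℕ} (hl0 : 1 ≤ l) (hl : l < n) {W : Type*}
    [AddCommGroup W] [Module ℂ W] [FiniteDimensional ℂ W] (σ : Representation ℂ (symSub n l) W)
    (hσ : σ.IsIrreducible) {S : Type} [Fintype S] [DecidableEq S] (x₀ : Tabloid n (hook n k))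
    (π : S → (Tabloid n (hook n k) → ℂ) →ₗ[ℂ] W)
    (hπ : ∀ s g f, π s (permRep (symSub n l) _ g f) = σ g (π s f))
    (u : S → Tabloid n (hook n k) → ℂ)
    (hu : ∀ s y, u s y ≠ 0 → y ∈ MulAction.orbit (symSub n (l + 1)) x₀)
    (φ : W →ₗ[ℂ] ℂ) (hφ : ∀ s s', φ (π s (u s')) = if s = s' then 1 else 0) :
    Fintype.card S ≤ N k := by
  classical
  set O := MulAction.orbit (symSub n (l + 1)) x₀ with hO
  set z := zeros (l + 1) x₀ with hz
  let I : ℕ → Submodule ℂ W := fixedVectors fun i => σ (gen n l i)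
  have hOz : ∀ x ∈ O, zeros (l + 1) x = z := by
    rintro _ ⟨g, rfl⟩
    exact zeros_smul g.2 x₀
  have hOtail : ∀ x ∈ O, ∀ a : Fin n, l + 1 ≤ a → x.1 a = x₀.1 a := by
    rintro _ ⟨g, rfl⟩ a ha
    exact smul_tail g.2 x₀ ha
  have hOsmul : ∀ g ∈ symSub n l, ∀ x ∈ O, g • x ∈ O := by
    rintro g hg _ ⟨h, rfl⟩
    exact ⟨⟨g, symSub_mono (Nat.le_succ l) hg⟩ * h, mul_smul (⟨g, _⟩ : symSub n (l + 1)) h x₀⟩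
  -- One representative for each `S_l`-orbit in `O`, indexed by the row `w` of the point `l`; it is
  -- sorted so that its invariance is under an initial subgroup `S_r`. The value `0` stands for rows
  -- that do not occur.
  have hrep : ∀ w : Fin (k + 1), ∃ d : Tabloid n (hook n k) → ℂ,
      (∀ x ∈ O, x.1 ⟨l, hl⟩ = w → ∃ g : symSub n l, permRep (symSub n l) _ g d = Pi.single x 1) ∧
      (d = 0 ∨ ∃ x ∈ O, x.1 ⟨l, hl⟩ = w ∧ d = Pi.single x 1 ∧
        ∀ a : Fin n, (a : ℕ) < zeros l x → x.1 a = 0) := by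
    intro w
    by_cases hw : ∃ x ∈ O, x.1 ⟨l, hl⟩ = w
    · obtain ⟨x, hx, hxw⟩ := hw
      obtain ⟨g, hg, hgx⟩ := exists_smul_sorted hl.le x
      have hgw : (g • x).1 ⟨l, hl⟩ = w := (smul_tail hg x (le_refl l)).trans hxw
      refine ⟨Pi.single (g • x) 1, fun y hy hyw => ?_,
        Or.inr ⟨g • x, hOsmul g hg x hx, hgw, rfl, by rwa [zeros_smul hg]⟩⟩
      obtain ⟨h, hh, hhy⟩ := exists_smul_eq (l := l) (g • x) y fun a ha => by
        by_cases hal : (a : ℕ) = l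
        · obtain rfl : a = ⟨l, hl⟩ := Fin.ext hal
          rw [hgw, hyw]
        · rw [hOtail _ (hOsmul g hg x hx) a (by omega), hOtail y hy a (by omega)]
      refine ⟨⟨h, hh⟩, ?_⟩
      rw [permRep_single, ← hhy]
      rfl
    · exact ⟨0, fun x hx hxw => absurd ⟨x, hx, hxw⟩ hw, Or.inl rfl⟩
  choose d hd hd' using hrep
  -- The value at a sorted representative is fixed by `S_r`, with `r` the number of first-row points
  -- below `l`: this is `z - 1` if the point `l` is itself in the first row and `z` otherwise.
  let J : Fin (k + 1) → Submodule ℂ W := Fin.cases (if 1 ≤ z then I (z - 1) else ⊥)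
    fun i => if i ∈ lowRows (l + 1) x₀ then I z else ⊥
  have hI : ∀ s x r, r ≤ l → (∀ a : Fin n, (a : ℕ) < r → x.1 a = 0) →
      π s (Pi.single x 1) ∈ I r := by
    intro s x r hr hx i hi
    change σ (gen n l i) _ = _
    rw [← hπ, permRep_single, smul_eq_self_of_forall x hr hl.le hx hi]
  have hJ : ∀ w s, π s (d w) ∈ J w := by
    intro w s
    rcases hd' w with h0 | ⟨x, hx, hxw, hdx, hsort⟩
    · rw [h0, map_zero]
      exact Submodule.zero_mem _
    · have hzx := zeros_succ hl x
      rw [hOz x hx] at hzx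
      have hmem := hI s x _ (zeros_le hl.le x) hsort
      rw [hdx]
      induction w using Fin.cases with
      | zero =>
        rw [if_pos hxw] at hzx
        change _ ∈ if 1 ≤ z then I (z - 1) else ⊥
        rw [if_pos (by omega), hzx]
        exact hmem
      | succ i =>
        rw [if_neg (by rw [hxw]; exact Fin.succ_ne_zero i), add_zero] at hzx
        change _ ∈ if i ∈ lowRows (l + 1) x₀ then I z else ⊥
        rw [if_pos, hzx]
        · exact hmem
        · refine Finset.mem_filter.2 ⟨Finset.mem_univ _, fun a ha hai => ?_⟩
          have := (x.existsUnique_succ i).unique ((hOtail x hx a ha).trans hai) hxw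
          rw [this] at ha
          simp at ha
  let Ψ : (S → ℂ) →ₗ[ℂ] (∀ w, J w) := LinearMap.pi fun w =>
    (Fintype.linearCombination ℂ fun s => π s (d w)).codRestrict (J w) fun c => by
      rw [Fintype.linearCombination_apply]
      exact Submodule.sum_mem _ fun s _ => Submodule.smul_mem _ _ (hJ w s)
  have hΨ : Function.Injective Ψ := by
    rw [← LinearMap.ker_eq_bot, LinearMap.ker_eq_bot']
    intro c hc
    have h0 : ∀ w, ∑ s, c s • π s (d w) = 0 := by
      intro w
      have := congrArg Subtype.val (congrFun hc w)
      rw [← Fintype.linearCombination_apply]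
      exact this
    let T : (Tabloid n (hook n k) → ℂ) →ₗ[ℂ] W := ∑ s, c s • π s
    have hT : ∀ f, T f = ∑ s, c s • π s f := fun f => by
      simp only [T, LinearMap.sum_apply, LinearMap.smul_apply]
    -- By equivariance, a combination that vanishes at the representatives vanishes on all functions
    -- supported on `O`, hence on each `u s`, where `φ` reads off the coefficient `c s`.
    have hTO : ∀ x ∈ O, T (Pi.single x 1) = 0 := by
      intro x hx
      obtain ⟨g, hg⟩ := hd _ x hx rfl
      rw [← hg, hT]
      simp only [hπ, ← (σ g).map_smul, ← map_sum (σ g), h0, map_zero]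
    funext s
    have hTu : T (u s) = 0 := by
      rw [pi_eq_sum_univ' (u s), map_sum]
      refine Finset.sum_eq_zero fun x _ => ?_
      rw [map_smul]
      by_cases hx : u s x = 0
      · rw [hx, zero_smul]
      · rw [hTO x (hu s x hx), smul_zero]
    have := congrArg φ hTu
    rw [hT, map_sum, map_zero] at this
    simpa [hφ] using this
  have hfin := LinearMap.finrank_le_finrank_of_injective hΨ
  rw [Module.finrank_fintype_fun_eq_card, Module.finrank_pi_fintype, Fin.sum_univ_succ] at hfin
  have hsum : ∑ i : Fin k, Module.finrank ℂ (J i.succ) =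
      (lowRows (l + 1) x₀).card * Module.finrank ℂ (I z) := by
    rw [Finset.card_eq_sum_ones, Finset.sum_mul, one_mul, ← Finset.sum_filter_add_sum_filter_not
      Finset.univ (fun i => i ∈ lowRows (l + 1) x₀), Finset.filter_mem_eq_inter,
      Finset.univ_inter]
    rw [Finset.sum_eq_zero (s := Finset.univ.filter fun i => i ∉ lowRows (l + 1) x₀), add_zero]
    · refine Finset.sum_congr rfl fun i hi => ?_
      change Module.finrank ℂ ((if i ∈ lowRows (l + 1) x₀ then I z else ⊥ : Submodule ℂ W)) = _
      rw [if_pos hi]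
    · intro i hi
      change Module.finrank ℂ ((if i ∈ lowRows (l + 1) x₀ then I z else ⊥ : Submodule ℂ W)) = _
      rw [if_neg (Finset.mem_filter.1 hi).2, finrank_bot]
  rw [hsum] at hfin
  refine hfin.trans ?_
  have hzle : z ≤ l + 1 := zeros_le hl x₀
  have hzk : l + 1 - z ≤ k := sub_zeros_le hl x₀
  have hlow : (lowRows (l + 1) x₀).card ≤ l + 1 - z := card_lowRows_le hl x₀
  change Module.finrank ℂ ((if 1 ≤ z then I (z - 1) else ⊥ : Submodule ℂ W)) + _ ≤ _
  by_cases hz1 : 1 ≤ z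
  · rw [if_pos hz1]
    -- The appended cells bring the size of `μ` to `z - 1 + k`; the subtraction is not truncated,
    -- because `l + 1 - z ≤ k`.
    obtain ⟨μ, hμ, hle⟩ := finrank_fixedVectors_le hl0 hl.le σ hσ (z - 1 + k - l)
    refine le_trans (Nat.add_le_add (hle (z - 1) (by omega)) ?_)
      (numSkew_add_le_N (μ := μ) (z := z - 1) (by omega))
    rw [Nat.sub_add_cancel hz1]
    -- Otherwise `z = l + 1`, and no single-cell row has its entry among the first `l + 1` points.
    by_cases hzl : z ≤ l
    · exact Nat.mul_le_mul (hlow.trans hzk) (hle z hzl)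
    · rw [show (lowRows (l + 1) x₀).card = 0 by omega, zero_mul]
      exact Nat.zero_le _
  -- For `z = 0` only single-cell rows contribute. Invariance under `S_0` or `S_1` is no condition,
  -- so `I 0` is bounded through the row of length 1.
  · rw [if_neg hz1, finrank_bot, zero_add]
    obtain ⟨μ, hμ, hle⟩ := finrank_fixedVectors_le hl0 hl.le σ hσ (k - l)
    refine le_trans ?_ (numSkew_add_le_N (μ := μ) (z := 0) (by omega))
    refine le_trans (Nat.mul_le_mul (hlow.trans hzk) (le_trans (Submodule.finrank_mono ?_)
      (hle 1 hl0))) (Nat.le_add_left _ _)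
    intro v _ i hi
    omega

/-! ### Coordinates in symmetry adapted bases -/

section Blocks

variable {G V ι : Type} [Group G] [AddCommGroup V] [Module ℂ V]
  {r : ℕ} {ρ : Fin r → MatRep G}

/-- The coordinates that belong to a block of a symmetry adapted basis. -/
noncomputable def blockCoords (b : Module.Basis ι ℂ V) (e : ι ≃ (s : Fin r) × Fin (ρ s).dim)
    (s : Fin r) : V →ₗ[ℂ] (Fin (ρ s).dim → ℂ) :=
  LinearMap.pi fun p => b.coord (e.symm ⟨s, p⟩)

/-- The subspace spanned by a block of a symmetry adapted basis. -/
noncomputable def blockIncl (b : Module.Basis ι ℂ V) (e : ι ≃ (s : Fin r) × Fin (ρ s).dim)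
    (s : Fin r) : (Fin (ρ s).dim → ℂ) →ₗ[ℂ] V :=
  Fintype.linearCombination ℂ fun p => b (e.symm ⟨s, p⟩)

theorem MatRep.toRep_apply (σ : MatRep G) (g : G) (v : Fin σ.dim → ℂ) :
    σ.toRep g v = (σ.hom g).mulVec v := rfl

theorem blockCoords_equivariant [Fintype ι] [DecidableEq ι] {τ : Representation ℂ G V}
    {b : Module.Basis ι ℂ V} {e : ι ≃ (s : Fin r) × Fin (ρ s).dim}
    (h : ∀ g, (LinearMap.toMatrix b b (τ g)).reindex e e =
      Matrix.blockDiagonal' fun s => (ρ s).hom g) (s : Fin r) (g : G) (v : V) :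
    blockCoords b e s (τ g v) = (ρ s).toRep g (blockCoords b e s v) := by
  funext p
  have h1 := congrFun (LinearMap.toMatrix_mulVec_repr b b (τ g) v) (e.symm ⟨s, p⟩)
  change b.repr (τ g v) (e.symm ⟨s, p⟩) = _
  rw [← h1, MatRep.toRep_apply, Matrix.mulVec, Matrix.mulVec, dotProduct, dotProduct,
    ← Equiv.sum_comp e.symm, Fintype.sum_sigma, Finset.sum_eq_single s]
  · refine Finset.sum_congr rfl fun q _ => ?_
    have h2 := congrFun (congrFun (h g) ⟨s, p⟩) ⟨s, q⟩
    rw [Matrix.blockDiagonal'_apply_eq] at h2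
    rw [← h2]
    rfl
  · intro s' _ hne
    refine Finset.sum_eq_zero fun q _ => ?_
    have h2 := congrFun (congrFun (h g) ⟨s, p⟩) ⟨s', q⟩
    rw [Matrix.blockDiagonal'_apply_ne _ _ _ hne.symm] at h2
    change LinearMap.toMatrix b b (τ g) (e.symm ⟨s, p⟩) (e.symm ⟨s', q⟩) = 0 at h2
    rw [h2, zero_mul]
  · exact fun hs => absurd (Finset.mem_univ s) hs

theorem blockCoords_blockIncl_self (b : Module.Basis ι ℂ V)
    (e : ι ≃ (s : Fin r) × Fin (ρ s).dim) (s : Fin r) (c : Fin (ρ s).dim → ℂ) :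
    blockCoords b e s (blockIncl b e s c) = c := by
  classical
  funext p
  change b.coord (e.symm ⟨s, p⟩) _ = _
  rw [blockIncl, Fintype.linearCombination_apply, map_sum, Finset.sum_eq_single p]
  · simp
  · intro q _ hq
    rw [map_smul, Module.Basis.coord_apply, Module.Basis.repr_self, Finsupp.single_eq_of_ne,
      smul_zero]
    simpa using hq.symm
  · exact fun hp => absurd (Finset.mem_univ p) hp

theorem blockCoords_blockIncl_of_ne (b : Module.Basis ι ℂ V)
    (e : ι ≃ (s : Fin r) × Fin (ρ s).dim) {s t : Fin r} (hst : t ≠ s) (c : Fin (ρ s).dim → ℂ) :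
    blockCoords b e t (blockIncl b e s c) = 0 := by
  classical
  funext p
  change b.coord (e.symm ⟨t, p⟩) _ = _
  rw [blockIncl, Fintype.linearCombination_apply, map_sum]
  refine Finset.sum_eq_zero fun q _ => ?_
  rw [map_smul, Module.Basis.coord_apply, Module.Basis.repr_self, Finsupp.single_eq_of_ne,
    smul_zero]
  intro he
  exact hst (congrArg Sigma.fst (e.symm.injective he))

theorem ext_blockCoords (b : Module.Basis ι ℂ V) (e : ι ≃ (s : Fin r) × Fin (ρ s).dim) {v w : V}
    (h : ∀ s, blockCoords b e s v = blockCoords b e s w) : v = w := by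
  refine b.ext_elem fun i => ?_
  have := congrFun (h (e i).1) (e i).2
  change b.repr v (e.symm (e i)) = b.repr w (e.symm (e i)) at this
  rwa [e.symm_apply_apply] at this

theorem blockIncl_equivariant [Fintype ι] [DecidableEq ι] {τ : Representation ℂ G V}
    {b : Module.Basis ι ℂ V} {e : ι ≃ (s : Fin r) × Fin (ρ s).dim}
    (h : ∀ g, (LinearMap.toMatrix b b (τ g)).reindex e e =
      Matrix.blockDiagonal' fun s => (ρ s).hom g) (s : Fin r) (g : G) (c : Fin (ρ s).dim → ℂ) :
    blockIncl b e s ((ρ s).toRep g c) = τ g (blockIncl b e s c) := by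
  refine ext_blockCoords b e fun t => ?_
  rw [blockCoords_equivariant h]
  by_cases hts : t = s
  · subst hts
    rw [blockCoords_blockIncl_self, blockCoords_blockIncl_self]
  · rw [blockCoords_blockIncl_of_ne b e hts, blockCoords_blockIncl_of_ne b e hts, map_zero]

/-- Schur's lemma for the members of a system of irreducible matrix representations. -/
theorem IsIrredSystem.schur {R : Set (MatRep G)} (hR : IsIrredSystem R) {σ σ' : MatRep G}
    (hσ : σ ∈ R) (hσ' : σ' ∈ R) (f : Representation.IntertwiningMap σ.toRep σ'.toRep)
    (q : Fin σ.dim) (p : Fin σ'.dim) (h : f (Pi.single q 1) p ≠ 0) :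
    σ' = σ ∧ (p : ℕ) = q := by
  have h1 := hR.irreducible σ hσ
  have h2 := hR.irreducible σ' hσ'
  have hbij : Function.Bijective f := by
    refine (Representation.IsIrreducible.bijective_or_eq_zero f).resolve_right fun h0 => h ?_
    rw [h0]
    rfl
  obtain rfl := hR.inequivalent σ hσ σ' hσ' ⟨f.ofBijective hbij⟩
  refine ⟨rfl, ?_⟩
  -- Over `ℂ` a self-intertwiner is a scalar, so its matrix has no entries off the diagonal.
  obtain ⟨c, rfl⟩ :=
    Representation.IsIrreducible.algebraMap_intertwiningMap_bijective_of_isAlgClosed.2 f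
  by_contra hne
  apply h
  change (c • (Pi.single q 1 : Fin σ.dim → ℂ)) p = 0
  rw [Pi.smul_apply, Pi.single_eq_of_ne (fun e => hne (congrArg Fin.val e)), smul_zero]

end Blocks

/-- A function supported outside of the orbit of an orbital basis vector has no coordinate
at that vector. -/
theorem IsOrbital.repr_eq_zero {H X ι : Type} [Group H] [MulAction H X]
    {b : Module.Basis ι ℂ (X → ℂ)} (hb : IsOrbital H b) {i : ι} {x : X}
    (hx : ∀ y, b i y ≠ 0 → y ∈ MulAction.orbit H x) {f : X → ℂ}
    (hf : ∀ y, f y ≠ 0 → y ∉ MulAction.orbit H x) : b.repr f i = 0 := by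
  classical
  -- Truncation to the orbit fixes each basis vector supported there and kills the others, among
  -- which `b i` is not; hence it does not change the coordinate at `i`.
  let P : (X → ℂ) →ₗ[ℂ] (X → ℂ) :=
    { toFun := fun f y => if y ∈ MulAction.orbit H x then f y else 0
      map_add' := fun f g => by funext y; by_cases h : y ∈ MulAction.orbit H x <;> simp [h]
      map_smul' := fun c f => by funext y; by_cases h : y ∈ MulAction.orbit H x <;> simp [h] }
  have hPf : ∀ (f : X → ℂ) y, P f y = if y ∈ MulAction.orbit H x then f y else 0 := fun _ _ => rfl
  have hP : b.coord i ∘ₗ P = b.coord i := by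
    refine b.ext fun t => ?_
    rw [LinearMap.comp_apply]
    by_cases ht : ∃ y, y ∈ MulAction.orbit H x ∧ b t y ≠ 0
    · obtain ⟨y, hy, hty⟩ := ht
      obtain ⟨x', hx'⟩ := hb t
      have horb : MulAction.orbit H x' = MulAction.orbit H x :=
        (MulAction.orbit_eq_iff.2 (hx' y hty)).symm.trans (MulAction.orbit_eq_iff.2 hy)
      congr 1
      funext w
      rw [hPf]
      split_ifs with hw
      · rfl
      · by_contra hcon
        exact hw (horb ▸ hx' w (Ne.symm hcon))
    · push Not at ht
      have h0 : P (b t) = 0 := by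
        funext w
        rw [hPf]
        split_ifs with hw
        · exact ht w hw
        · rfl
      have hti : t ≠ i := by
        rintro rfl
        apply b.ne_zero t
        funext w
        by_contra hcon
        exact hcon (ht w (hx w hcon))
      rw [h0, map_zero, Module.Basis.coord_apply, Module.Basis.repr_self,
        Finsupp.single_eq_of_ne hti.symm]
  have h1 := LinearMap.congr_fun hP f
  rw [LinearMap.comp_apply, show P f = 0 by
    funext y
    rw [hPf]
    split_ifs with hy
    · by_contra hcon
      exact hf y hcon hy
    · rfl, map_zero] at h1
  exact h1.symm

/-- The change between symmetry adapted bases that are orbital for consecutive groups in the chain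
has few nonzero entries in each row. -/
theorem card_nonzero_le_N {n k l m : ℕ} (hl0 : 1 ≤ l) (hl : l < n)
    {R : Set (MatRep (symSub n l))} (hR : IsIrredSystem R)
    {b b' : Module.Basis (Fin m) ℂ (Tabloid n (hook n k) → ℂ)}
    (hb : IsSymmetryAdapted (permRep (symSub n l) (Tabloid n (hook n k))) R b)
    (hb' : IsSymmetryAdapted (permRep (symSub n l) (Tabloid n (hook n k))) R b')
    (hob : IsOrbital (symSub n l) b) (hob' : IsOrbital (symSub n (l + 1)) b') (i : Fin m)
    (s : Finset (Fin m)) (hs : ∀ i' ∈ s, b'.toMatrix b i i' ≠ 0) : s.card ≤ N k := by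
  classical
  obtain ⟨r, ρ, e, hρ, he⟩ := hb
  obtain ⟨r', ρ', e', hρ', he'⟩ := hb'
  obtain ⟨x₀, hx₀⟩ := hob' i
  -- Including the block of `i'` and projecting to the block of `i` is an intertwiner, and the
  -- matrix entry of the change of basis is one of its entries.
  have hmatch : ∀ i' ∈ s, ρ' (e' i).1 = ρ (e i').1 ∧ ((e' i).2 : ℕ) = (e i').2 := by
    intro i' hi'
    let f : Representation.IntertwiningMap (ρ (e i').1).toRep (ρ' (e' i).1).toRep :=
      ⟨blockCoords b' e' (e' i).1 ∘ₗ blockIncl b e (e i').1, fun g => LinearMap.ext fun c => by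
        rw [LinearMap.comp_apply, LinearMap.comp_apply, LinearMap.comp_apply, LinearMap.comp_apply,
          blockIncl_equivariant he, blockCoords_equivariant he']⟩
    refine hR.schur (hρ _) (hρ' _) f (e i').2 (e' i).2 ?_
    have h1 : f (Pi.single (e i').2 1) (e' i).2 = b'.toMatrix b i i' := by
      change b'.repr (blockIncl b e (e i').1 (Pi.single (e i').2 1)) (e'.symm (e' i)) = _
      rw [blockIncl, Fintype.linearCombination_apply_single, one_smul, e'.symm_apply_apply,
        show (⟨(e i').1, (e i').2⟩ : (s : Fin r) × Fin (ρ s).dim) = e i' from rfl,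
        e.symm_apply_apply, Module.Basis.toMatrix_apply]
    rw [h1]
    exact hs i' hi'
  have hcoord : ∀ i' : s, ∃ π : (Tabloid n (hook n k) → ℂ) →ₗ[ℂ] (Fin (ρ' (e' i).1).dim → ℂ),
      (∀ g f, π (permRep (symSub n l) _ g f) = (ρ' (e' i).1).toRep g (π f)) ∧
        ∀ f, π f (e' i).2 = b.repr f i' := by
    rintro ⟨i', hi'⟩
    -- With σ and the position left variable, the equalities from `hmatch` can be substituted, so
    -- that all block projections take values in one common space.
    have key : ∀ σ : MatRep (symSub n l), σ = ρ (e i').1 → ∀ p : Fin σ.dim, (p : ℕ) = (e i').2 →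
        ∃ π : (Tabloid n (hook n k) → ℂ) →ₗ[ℂ] (Fin σ.dim → ℂ),
          (∀ g f, π (permRep (symSub n l) _ g f) = σ.toRep g (π f)) ∧
            ∀ f, π f p = b.repr f i' := by
      rintro _ rfl p hp
      refine ⟨blockCoords b e (e i').1, blockCoords_equivariant he _, fun f => ?_⟩
      obtain rfl : p = (e i').2 := Fin.ext hp
      change b.repr f (e.symm (e i')) = _
      rw [e.symm_apply_apply]
    exact key _ (hmatch i' hi').1 _ (hmatch i' hi').2
  choose π hπ hπ' using hcoord
  rw [← Fintype.card_coe]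
  refine card_intertwiners_le_N hl0 hl (ρ' (e' i).1).toRep (hR.irreducible _ (hρ' _)) x₀ π hπ
    (fun i' : s => b i') (fun i' y hy => ?_) (LinearMap.proj (e' i).2) fun i' i'' => ?_
  · obtain ⟨x₁, hx₁⟩ := hob i'
    have hle : ∀ y, y ∈ MulAction.orbit (symSub n l) x₁ →
        y ∈ MulAction.orbit (symSub n (l + 1)) x₁ := by
      rintro _ ⟨g, rfl⟩
      exact ⟨⟨g.1, symSub_mono (Nat.le_succ l) g.2⟩, rfl⟩
    -- If `b i'` were nonzero somewhere outside the orbit of `x₀`, its whole support would lie in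
    -- another `S_{l+1}`-orbit and its coordinate at `i` would vanish.
    by_contra hcon
    refine hs i' i'.2 ?_
    rw [Module.Basis.toMatrix_apply]
    refine hob'.repr_eq_zero hx₀ fun w hw hw' => hcon ?_
    have h1 := MulAction.orbit_eq_iff.2 (hle y (hx₁ y hy))
    have h2 := MulAction.orbit_eq_iff.2 (hle w (hx₁ w hw))
    have h3 := MulAction.orbit_eq_iff.2 hw'
    rw [← h3, h2, ← h1]
    exact MulAction.mem_orbit_self y
  · rw [LinearMap.proj_apply, hπ', Module.Basis.repr_self, Finsupp.single_apply]
    simp only [Subtype.ext_iff, eq_comm]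

end TabloidFFT

/-! ### The two bounds -/

theorem theorem14 (n k : ℕ) (hn : 2 ≤ n) (hk : k < n)
    (R : (j : ℕ) → Set (TabloidFFT.MatRep (TabloidFFT.symSub n j)))
    (hR : ∀ j, 1 ≤ j → j ≤ n → TabloidFFT.IsIrredSystem (R j))
    (hcomp : TabloidFFT.AreCompatible (TabloidFFT.Tabloid n (TabloidFFT.hook n k)) R)
    (m : ℕ)
    (B : ℕ → Module.Basis (Fin m) ℂ (TabloidFFT.Tabloid n (TabloidFFT.hook n k) → ℂ))
    (hB : ∀ j, 1 ≤ j → j ≤ n → TabloidFFT.IsAdaptedUpTo R j (B j) ∧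
      TabloidFFT.IsOrbital (TabloidFFT.symSub n j) (B j))
    (hB1 : TabloidFFT.IsStandard (B 1)) :
    TabloidFFT.omega ((B n).toMatrix (B 1)) <
        2 * TabloidFFT.N k * (n - 1) * n.descFactorial k ∧
      TabloidFFT.omega ((B n).toMatrix (B 1)) < 2 * n.descFactorial k ^ 2 := by
  have hm : m = n.descFactorial k := by
    have h1 := Module.finrank_eq_card_basis (B 1)
    rw [Module.finrank_fintype_fun_eq_card, Fintype.card_fin,
      TabloidFFT.card_tabloid_hook] at h1
    exact h1.symm
  have hm0 : 0 < m := by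
    rw [hm]
    exact Nat.descFactorial_pos.2 hk.le
  have hrow : ∀ j < n - 1, ∀ i, ∀ s : Finset (Fin m),
      (∀ i' ∈ s, (B (j + 2)).toMatrix (B (j + 1)) i i' ≠ 0) → s.card ≤ TabloidFFT.N k := by
    intro j hj
    obtain ⟨h1, h2⟩ := hB (j + 1) (by omega) (by omega)
    obtain ⟨h3, h4⟩ := hB (j + 2) (by omega) (by omega)
    exact TabloidFFT.card_nonzero_le_N (by omega) (by omega) (hR (j + 1) (by omega) (by omega))
      (h1 (j + 1) (by omega) le_rfl) (h3 (j + 1) (by omega) (by omega)) h2 h4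
  -- Positivity makes `2 * N k - 1` strictly smaller than `2 * N k`. It holds because an invertible
  -- matrix has a nonzero entry in every row.
  have hN : 1 ≤ TabloidFFT.N k := by
    let i : Fin m := ⟨0, hm0⟩
    obtain ⟨i', hi'⟩ : ∃ i', (B 2).toMatrix (B 1) i i' ≠ 0 := by
      by_contra hcon
      push Not at hcon
      have h1 := congrFun (congrFun ((B 2).toMatrix_mul_toMatrix_flip (B 1)) i) i
      rw [Matrix.mul_apply, Matrix.one_apply_eq] at h1
      simp [hcon] at h1
    have := hrow 0 (by omega) i {i'} (by simpa using hi')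
    rwa [Finset.card_singleton] at this
  constructor
  · have h1 := TabloidFFT.omega_toMatrix_le B (TabloidFFT.N k) (n - 1) hrow
    rw [Nat.sub_add_cancel (by omega : 1 ≤ n), Fintype.card_fin] at h1
    refine lt_of_le_of_lt h1 ?_
    rw [← hm]
    have h2 : 2 * TabloidFFT.N k * (n - 1) * m = (n - 1) * (m * (2 * TabloidFFT.N k)) := by ring
    rw [h2]
    exact Nat.mul_lt_mul_of_pos_left (Nat.mul_lt_mul_of_pos_left (by omega) hm0) (by omega)
  · have h1 := TabloidFFT.omega_le_naive ((B n).toMatrix (B 1))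
    rw [Fintype.card_fin] at h1
    refine lt_of_le_of_lt h1 ?_
    rw [← hm, show 2 * m ^ 2 = m * (2 * m) by ring]
    exact Nat.mul_lt_mul_of_pos_left (by omega) hm0
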